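/- Let $\mathcal A$ be a non-empty finite alphabet with $n_a$ letters, let $L\ge 2$, and let $\varrho:\mathcal A\to\mathcal A^L$, $a\mapsto \varrho(a)=\varrho(a)_0\varrho(a)_1\cdots\varrho(a)_{L-1}$, be a substitution of constant length $L$. Its $m$-th column is the map $a\mapsto\varrho(a)_m$, $0\le m<L$. Assume that every column is bijective or constant, and that the group $G'$ of permutations of $\mathcal A$ generated by the bijective columns is Abelian (not necessarily transitive). Let $S_{\mathsf b}$ be the set of those $m$ for which the $m$-th column is bijective. For $k\in\mathbb R$ put $u=\mathrm e^{2\pi\mathrm i k}$, and let $B(k)$ be the Fourier matrix and $B_{\mathsf b}(k)$ its bijective part, $$B(k)_{ij}=\sum_{m:\ \varrho(j)_m=i}u^m,\qquad B_{\mathsf b}(k)_{ij}=\sum_{m\in S_{\mathsf b}:\ \varrho(j)_m=i}u^m\qquad(i,j\in\mathcal A).$$ For a polynomial $p\ne0$ let $\mathfrak m(p)=\int_0^1\log|p(\mathrm e^{2\pi\mathrm i t})|\,\mathrm dt$ be its logarithmic Mahler measure (for $p=0$, which is possible below only if $S_{\mathsf b}=\varnothing$, one may put $\mathfrak m(0)=0$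 or $\mathfrak m(0)=-\infty$, with no effect on the claim). Then there are linearly independent vectors $b_1,\dots,b_{n_a-1}\in\mathbb C^{\mathcal A}$ and complex polynomials $\beta_1,\dots,\beta_{n_a-1}$ of degree less than $L$ such that the following holds. (1) For all $j$ and $k$, one has $B_{\mathsf b}(k)\,b_j=\beta_j(u)\,b_j$ and $B(k)\,b_j=\beta_j(u)\,b_j$ (the eigenvalues inherited from the bijective part). For every $k$, the eigenvalues of $B_{\mathsf b}(k)$, with multiplicities, are $\sum_{m\in S_{\mathsf b}}u^m,\beta_1(u),\dots,\beta_{n_a-1}(u)$, while those of $B(k)$ are $\beta_1(u),\dots,\beta_{n_a-1}(u)$ and the remaining eigenvalue $1+u+\dots+u^{L-1}$. (2) $\mathfrak m(\beta_j)<\log\sqrt L$ for all $j$. (3) There is a constant $c<\log\sqrt L$ such that, for Lebesgue-a.e. $k\in\mathbb R$, $$\chi^B(k)=\lim_{n\to\infty}\tfrac1n\log\|B(k)B(Lk)\cdots B(L^{n-1}k)\|=c,$$ so the minimal exponent $\log\sqrt L-\chi^B(k)$ of the outward iteration is a.e. equal to a positive constant. (4) If at least one column is bijective, then, for Lebesgue-a.e.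 $k\in\mathbb R$, the matrices $B(L^nk)$, $n\ge0$, are invertible, and all Lyapunov exponents of the outward iteration $v\mapsto L^{n/2}B(L^{n-1}k)^{-1}\cdots B(Lk)^{-1}B(k)^{-1}v$ are strictly positive: for every $v\in\mathbb C^{\mathcal A}\setminus\{0\}$, the limit $$\chi(k,v)=\lim_{n\to\infty}\tfrac1n\log\bigl\|L^{n/2}B(L^{n-1}k)^{-1}\cdots B(Lk)^{-1}B(k)^{-1}v\bigr\|$$ exists, is $>0$, and is one of the numbers $\log\sqrt L-\mathfrak m(\beta_j)$, $1\le j\le n_a-1$, or $\log\sqrt L$. Here, $\chi(k,b_j)=\log\sqrt L-\mathfrak m(\beta_j)$ for all $j$, and $\chi(k,v)=\log\sqrt L$ for every $v$ outside the span of $b_1,\dots,b_{n_a-1}$. -/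

import Mathlib

open Polynomial Filter Topology MeasureTheory

/-- A substitution `a ↦ ϱ a 0, ϱ a 1, …, ϱ a (L-1)` of constant length `L` on the alphabet `A`:
every letter is sent to a word of length `L`. -/
abbrev ConstLengthSubst (A : Type*) (L : ℕ) := A → Fin L → A

namespace ConstLengthSubst

variable {A : Type*} {L : ℕ}

/-- The `m`-th column of the word vector `(ϱ a)_a`, as a self-map of the alphabet. -/
def column (ϱ : ConstLengthSubst A L) (m : Fin L) : A → A := fun a => ϱ a m

/-- The `m`-th column is bijective. -/
def BijectiveColumn (ϱ : ConstLengthSubst A L) (m : Fin L) : Prop :=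
  Function.Bijective (ϱ.column m)

/-- The `m`-th column is constant (a coincidence). -/
def ConstantColumn (ϱ : ConstLengthSubst A L) (m : Fin L) : Prop :=
  ∃ c, ∀ a, ϱ.column m a = c

/-- The permutation group generated by the bijective columns. -/
def columnGroup (ϱ : ConstLengthSubst A L) : Subgroup (Equiv.Perm A) :=
  Subgroup.closure {σ | ∃ m, ⇑σ = ϱ.column m}

noncomputable instance (ϱ : ConstLengthSubst A L) : DecidablePred ϱ.BijectiveColumn :=
  Classical.decPred _

/-- The phase `u = exp (2πik)`. -/
noncomputable def phase (k : ℝ) : ℂ := Complex.exp (2 * Real.pi * Complex.I * k)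

variable [DecidableEq A]

/-- The Fourier matrix of the inflation with unit tiles: the entry `(i, j)` is the sum of
`exp (2πitk)` over all positions `t` of the letter `i` in the word `ϱ j`. -/
noncomputable def fourierMatrix (ϱ : ConstLengthSubst A L) (k : ℝ) : Matrix A A ℂ :=
  Matrix.of fun i j => ∑ t with ϱ j t = i, phase k ^ (t : ℕ)

/-- The part of the Fourier matrix contributed by the bijective columns. -/
noncomputable def bijectivePart (ϱ : ConstLengthSubst A L) (k : ℝ) : Matrix A A ℂ :=
  Matrix.of fun i j => ∑ t with ϱ j t = i ∧ ϱ.BijectiveColumn t, phase k ^ (t : ℕ)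

variable [Fintype A]

/-- The Fourier matrix cocycle `B(k) B(Lk) ⋯ B(L^(n-1) k)`. -/
noncomputable def cocycle (ϱ : ConstLengthSubst A L) : ℕ → ℝ → Matrix A A ℂ
  | 0, _ => 1
  | n + 1, k => ϱ.fourierMatrix k * cocycle ϱ n (L * k)

/-- The matrix `L^(n/2) B(L^(n-1) k)⁻¹ ⋯ B(Lk)⁻¹ B(k)⁻¹` of the outward iteration. -/
noncomputable def outward (ϱ : ConstLengthSubst A L) : ℕ → ℝ → Matrix A A ℂ
  | 0, _ => 1
  | n + 1, k =>
    ((Real.sqrt L : ℝ) : ℂ) • ((ϱ.fourierMatrix ((L : ℝ) ^ n * k))⁻¹ * outward ϱ n k)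

/-- `χ` is the Lyapunov exponent, as a limit, of the outward iteration at `k` in the direction
of the vector `v`.  (All norms on `A → ℂ` give the same exponents.) -/
def HasLyapunovExponent (ϱ : ConstLengthSubst A L) (k : ℝ) (v : A → ℂ) (χ : ℝ) : Prop :=
  Tendsto (fun n : ℕ => (1 / (n : ℝ)) * Real.log ‖(ϱ.outward n k).mulVec v‖) atTop (𝓝 χ)

attribute [local instance] Matrix.linftyOpNormedAddCommGroup in
/-- `χ` is the maximal Lyapunov exponent, as a limit, of the Fourier matrix cocycle at `k`.
(All matrix norms give the same exponent; the maximal row sum norm is used.) -/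
def HasMaxCocycleExponent (ϱ : ConstLengthSubst A L) (k : ℝ) (χ : ℝ) : Prop :=
  Tendsto (fun n : ℕ => (1 / (n : ℝ)) * Real.log ‖ϱ.cocycle n k‖) atTop (𝓝 χ)

end ConstLengthSubst

/-!
The bijective columns act on `ℂ^A` as commuting permutation matrices, and every other column is
constant and hence kills the hyperplane of vectors with entry sum zero.  So that hyperplane has a
basis `b` of common eigenvectors of all column matrices (`exists_column_eigenbasis`), with
unimodular eigenvalues at the bijective columns; these eigenvalues are the coefficients of the
polynomials `β j`.  Completing `b` by the vector of ones, the Fourier matrix becomes diagonal up to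
its last column, with last diagonal entry `1 + u + ⋯ + u ^ (L - 1)`, because the entry sum is
multiplied by that factor.

Mahler measures: the nonzero coefficients of `β j` are unimodular, so `0 ≤ 𝔪(β j)`, and Landau's
inequality `M(p)² ≤ ∑ |coeff|²` gives `𝔪(β j) < log √L` if some column is not bijective.  If all are
bijective, Landau's inequality is applied to `p * (X ^ (L - 1) - a)` with `|a| = 1 / L`
(`mahlerMeasure_sq_lt_of_norm_coeff_eq_one`).

Exponents: multiplication by `L` on `ℝ / ℤ` is ergodic, so by Birkhoff's theorem (proved here by
Garsia's argument, `Ergodic.ae_tendsto_birkhoffSum`) the products of the values of a polynomial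
`p ≠ 0` along almost every orbit have exponential rate `𝔪(p)`; for the geometric sum this rate is
`0`.  In the adapted basis the cocycle and its inverse are given explicitly by such products and by
one shear term per eigenvector (`repr_cocycle_mulVec`, `repr_cocycle_inv_mulVec`), and as
`𝔪(β j) ≥ 0` the shear term does not exceed the rate of the corresponding product
(`expUpper_shear`).  Therefore the cocycle has the exponent `max (0, max_j 𝔪(β j))`, and the outward
iteration the exponents `log √L - 𝔪(β j)` on the span of `b` and `log √L` off it.
-/

/-! ### Birkhoff's pointwise ergodic theorem -/

section Birkhoff

variable {Ω : Type*}

/-- The running maximum `max (0, S₁ f, …, Sₙ f)` of the Birkhoff sums of `f`, in its recursive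
form. -/
noncomputable def birkhoffMax (T : Ω → Ω) (f : Ω → ℝ) : ℕ → Ω → ℝ
  | 0, _ => 0
  | n + 1, x => max 0 (f x + birkhoffMax T f n (T x))

lemma birkhoffMax_nonneg (T : Ω → Ω) (f : Ω → ℝ) (n : ℕ) (x : Ω) : 0 ≤ birkhoffMax T f n x := by
  cases n with
  | zero => exact le_rfl
  | succ n => exact le_max_left _ _

lemma birkhoffMax_le_succ (T : Ω → Ω) (f : Ω → ℝ) (n : ℕ) (x : Ω) :
    birkhoffMax T f n x ≤ birkhoffMax T f (n + 1) x := by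
  induction n generalizing x with
  | zero => exact birkhoffMax_nonneg T f 1 x
  | succ n ih => exact max_le_max le_rfl (by gcongr; exact ih (T x))

lemma birkhoffMax_monotone (T : Ω → Ω) (f : Ω → ℝ) (x : Ω) :
    Monotone fun n => birkhoffMax T f n x :=
  monotone_nat_of_le_succ fun n => birkhoffMax_le_succ T f n x

lemma birkhoffSum_le_birkhoffMax (T : Ω → Ω) (f : Ω → ℝ) (n : ℕ) (x : Ω) :
    birkhoffSum T f n x ≤ birkhoffMax T f n x := by
  induction n generalizing x with
  | zero => simp [birkhoffMax]
  | succ n ih =>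
    rw [birkhoffSum_succ']
    exact le_max_of_le_right (by gcongr; exact ih (T x))

lemma birkhoffMax_succ_sub (T : Ω → Ω) (f : Ω → ℝ) (n : ℕ) (x : Ω) :
    birkhoffMax T f (n + 1) x - birkhoffMax T f n (T x) =
      max (-birkhoffMax T f n (T x)) (f x) := by
  rw [birkhoffMax, max_sub_sub_right (0 : ℝ) _ _ |>.symm]
  simp

lemma bddAbove_birkhoffMax_comp_iff (T : Ω → Ω) (f : Ω → ℝ) (x : Ω) :
    BddAbove (Set.range fun n => birkhoffMax T f n (T x)) ↔
      BddAbove (Set.range fun n => birkhoffMax T f n x) := by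
  constructor
  · rintro ⟨K, hK⟩
    refine ⟨max 0 (f x + K), ?_⟩
    rintro _ ⟨n, rfl⟩
    refine (birkhoffMax_le_succ T f n x).trans (max_le_max le_rfl ?_)
    gcongr
    exact hK ⟨n, rfl⟩
  · rintro ⟨K, hK⟩
    refine ⟨K - f x, ?_⟩
    rintro _ ⟨n, rfl⟩
    have h1 : birkhoffMax T f (n + 1) x ≤ K := hK ⟨n + 1, rfl⟩
    have h2 : f x + birkhoffMax T f n (T x) ≤ birkhoffMax T f (n + 1) x := le_max_right _ _
    simp only
    linarith

variable [MeasurableSpace Ω] {μ : Measure Ω} {T : Ω → Ω} {f : Ω → ℝ}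

lemma measurable_birkhoffMax (hT : Measurable T) (hf : Measurable f) (n : ℕ) :
    Measurable (birkhoffMax T f n) := by
  induction n with
  | zero => exact measurable_const
  | succ n ih => exact measurable_const.max (hf.add (ih.comp hT))

lemma integrable_birkhoffMax (hT : MeasurePreserving T μ μ) (hf : Integrable f μ) (n : ℕ) :
    Integrable (birkhoffMax T f n) μ := by
  induction n with
  | zero => exact integrable_zero _ _ _
  | succ n ih =>
    exact (integrable_zero _ _ _).sup (hf.add (hT.integrable_comp_of_integrable ih))

/-- Garsia's argument: if the running maxima were unbounded on a set of full measure, then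
`∫ (Fₙ₊₁ - Fₙ ∘ T) = ∫ (Fₙ₊₁ - Fₙ) ≥ 0` would converge to `∫ f < 0`. -/
lemma Ergodic.ae_bddAbove_birkhoffMax (hT : Ergodic T μ)
    (hfm : Measurable f) (hf : Integrable f μ) (hneg : ∫ x, f x ∂μ < 0) :
    ∀ᵐ x ∂μ, BddAbove (Set.range fun n => birkhoffMax T f n x) := by
  have hmp := hT.toMeasurePreserving
  set A : Set Ω := {x | BddAbove (Set.range fun n => birkhoffMax T f n x)} with hA
  have hAm : MeasurableSet A :=
    measurableSet_bddAbove_range fun n => measurable_birkhoffMax hmp.measurable hfm n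
  have hTA : T ⁻¹' A = A := by
    ext x
    exact bddAbove_birkhoffMax_comp_iff T f x
  rcases hT.toPreErgodic.ae_mem_or_ae_notMem hAm hTA with h | h
  · exact h
  exfalso
  have hlim : Tendsto (fun n => ∫ x, max (-birkhoffMax T f n (T x)) (f x) ∂μ) atTop
      (𝓝 (∫ x, f x ∂μ)) := by
    refine tendsto_integral_of_dominated_convergence (fun x => |f x|) (fun n => ?_) hf.abs
      (fun n => ?_) ?_
    · exact (((measurable_birkhoffMax hmp.measurable hfm n).comp
        hmp.measurable).neg.max hfm).aestronglyMeasurable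
    · refine ae_of_all _ fun x => ?_
      rw [Real.norm_eq_abs, abs_le]
      exact ⟨(neg_abs_le _).trans (le_max_right _ _),
        max_le ((neg_nonpos.2 (birkhoffMax_nonneg T f n _)).trans (abs_nonneg _)) (le_abs_self _)⟩
    · filter_upwards [h] with x hx
      have hx' : ¬ BddAbove (Set.range fun n => birkhoffMax T f n (T x)) := by
        rwa [bddAbove_birkhoffMax_comp_iff]
      have htop := tendsto_atTop_atTop_of_monotone' (birkhoffMax_monotone T f (T x)) hx'
      refine tendsto_const_nhds.congr' ?_
      filter_upwards [htop.eventually_ge_atTop (-f x)] with n hn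
      rw [max_eq_right]
      linarith
  refine absurd (ge_of_tendsto' hlim fun n => ?_) (not_le.2 hneg)
  have h1 := integrable_birkhoffMax hmp hf (n + 1)
  have h2 := integrable_birkhoffMax hmp hf n
  have h3 := hmp.integrable_comp_of_integrable h2
  have h4 : ∫ x, birkhoffMax T f n (T x) ∂μ = ∫ x, birkhoffMax T f n x ∂μ := by
    rw [← integral_map hmp.measurable.aemeasurable
      (by rw [hmp.map_eq]; exact h2.aestronglyMeasurable), hmp.map_eq]
  simp_rw [← birkhoffMax_succ_sub]
  rw [(integral_sub h1 h3 : ∫ x, (birkhoffMax T f (n + 1) x - birkhoffMax T f n (T x)) ∂μ = _),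
    h4, ← integral_sub h1 h2]
  exact integral_nonneg fun x => sub_nonneg.2 (birkhoffMax_le_succ T f n x)

lemma Ergodic.ae_eventually_birkhoffSum_lt [IsProbabilityMeasure μ] (hT : Ergodic T μ)
    (hfm : Measurable f) (hf : Integrable f μ) {ε : ℝ} (hε : 0 < ε) :
    ∀ᵐ x ∂μ, ∀ᶠ n : ℕ in atTop, 1 / (n : ℝ) * birkhoffSum T f n x < (∫ x, f x ∂μ) + ε := by
  set a := (∫ x, f x ∂μ) + ε / 2 with ha
  have hint : ∫ x, (f x - a) ∂μ < 0 := by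
    rw [integral_sub hf (integrable_const a)]
    simp [ha, hε]
  filter_upwards [hT.ae_bddAbove_birkhoffMax (hfm.sub_const a) (hf.sub (integrable_const a)) hint]
    with x hx
  obtain ⟨K, hK⟩ := hx
  have hlim : Tendsto (fun n : ℕ => K / (n : ℝ)) atTop (𝓝 0) :=
    tendsto_const_div_atTop_nhds_zero_nat K
  filter_upwards [hlim.eventually_lt_const (half_pos hε), eventually_gt_atTop 0] with n hn hn0
  have h1 : birkhoffSum T (fun x => f x - a) n x ≤ K :=
    (birkhoffSum_le_birkhoffMax T _ n x).trans (hK ⟨n, rfl⟩)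
  have h2 : birkhoffSum T (fun x => f x - a) n x = birkhoffSum T f n x - n * a := by
    simp [birkhoffSum, Finset.sum_sub_distrib]
  have hn' : (0 : ℝ) < n := by exact_mod_cast hn0
  have h3 : 1 / (n : ℝ) * birkhoffSum T f n x ≤ K / n + a := by
    rw [one_div, inv_mul_le_iff₀ hn', mul_add, mul_div_cancel₀ _ hn'.ne']
    linarith
  linarith

/-- **Birkhoff's pointwise ergodic theorem** for an ergodic transformation of a probability
space. -/
theorem Ergodic.ae_tendsto_birkhoffSum [IsProbabilityMeasure μ] (hT : Ergodic T μ)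
    (hfm : Measurable f) (hf : Integrable f μ) :
    ∀ᵐ x ∂μ, Tendsto (fun n : ℕ => 1 / (n : ℝ) * birkhoffSum T f n x) atTop
      (𝓝 (∫ x, f x ∂μ)) := by
  have hpos (m : ℕ) : (0 : ℝ) < 1 / (m + 1) := by positivity
  have hup : ∀ᵐ x ∂μ, ∀ m : ℕ, ∀ᶠ n : ℕ in atTop,
      1 / (n : ℝ) * birkhoffSum T f n x < (∫ x, f x ∂μ) + 1 / (m + 1) :=
    ae_all_iff.2 fun m => hT.ae_eventually_birkhoffSum_lt hfm hf (hpos m)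
  have hlo : ∀ᵐ x ∂μ, ∀ m : ℕ, ∀ᶠ n : ℕ in atTop,
      1 / (n : ℝ) * birkhoffSum T (fun x => -f x) n x < (∫ x, -f x ∂μ) + 1 / (m + 1) :=
    ae_all_iff.2 fun m => hT.ae_eventually_birkhoffSum_lt hfm.neg hf.neg (hpos m)
  filter_upwards [hup, hlo] with x h1 h2
  refine tendsto_order.2 ⟨fun a ha => ?_, fun a ha => ?_⟩
  · obtain ⟨m, hm⟩ := exists_nat_one_div_lt (sub_pos.2 ha)
    filter_upwards [h2 m] with n hn
    have h : birkhoffSum T (fun x => -f x) n x = -birkhoffSum T f n x := by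
      simp [birkhoffSum]
    rw [h, integral_neg, mul_neg] at hn
    linarith
  · obtain ⟨m, hm⟩ := exists_nat_one_div_lt (sub_pos.2 ha)
    filter_upwards [h1 m] with n hn
    linarith

end Birkhoff

/-! ### Exponential growth rates of sequences -/

section Growth

/-- The sequence `x` grows at most with exponential rate `χ`: for each `ε > 0` it is bounded by a
constant times `exp (n (χ + ε))`.  Lower bounds on the growth of a positive sequence are expressed
by applying this notion to its reciprocal. -/
def ExpUpper (x : ℕ → ℝ) (χ : ℝ) : Prop :=
  ∀ ε > 0, ∃ K > 0, ∀ n : ℕ, x n ≤ K * Real.exp (n * (χ + ε))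

variable {x y : ℕ → ℝ} {χ χ' : ℝ}

lemma ExpUpper.mono (hx : ExpUpper x χ) (h : ∀ n, y n ≤ x n) : ExpUpper y χ := by
  intro ε hε
  obtain ⟨K, hK, hb⟩ := hx ε hε
  exact ⟨K, hK, fun n => (h n).trans (hb n)⟩

lemma ExpUpper.mono_rate (hx : ExpUpper x χ) (h : χ ≤ χ') : ExpUpper x χ' := by
  intro ε hε
  obtain ⟨K, hK, hb⟩ := hx ε hε
  refine ⟨K, hK, fun n => (hb n).trans ?_⟩
  gcongr

lemma expUpper_const (c : ℝ) : ExpUpper (fun _ => c) 0 := by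
  intro ε hε
  refine ⟨max c 1, lt_max_of_lt_right one_pos, fun n => (le_max_left c 1).trans ?_⟩
  refine le_mul_of_one_le_right (le_max_of_le_right zero_le_one) (Real.one_le_exp ?_)
  positivity

lemma ExpUpper.mul (hx : ExpUpper x χ) (hy : ExpUpper y χ') (hy0 : ∀ n, 0 ≤ y n) :
    ExpUpper (fun n => x n * y n) (χ + χ') := by
  intro ε hε
  obtain ⟨K, hK, hb⟩ := hx (ε / 2) (half_pos hε)
  obtain ⟨K', hK', hb'⟩ := hy (ε / 2) (half_pos hε)
  refine ⟨K * K', mul_pos hK hK', fun n => ?_⟩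
  calc x n * y n ≤ K * Real.exp (n * (χ + ε / 2)) * (K' * Real.exp (n * (χ' + ε / 2))) :=
        mul_le_mul (hb n) (hb' n) (hy0 n) (by positivity)
    _ = K * K' * Real.exp (n * (χ + χ' + ε)) := by
        rw [mul_mul_mul_comm, ← Real.exp_add]
        congr 2
        ring

lemma ExpUpper.const_mul (hx : ExpUpper x χ) {c : ℝ} (hc : 0 ≤ c) :
    ExpUpper (fun n => c * x n) χ := by
  intro ε hε
  obtain ⟨K, hK, hb⟩ := hx ε hε
  refine ⟨(c + 1) * K, by positivity, fun n => ?_⟩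
  calc c * x n ≤ c * (K * Real.exp (n * (χ + ε))) := by gcongr; exact hb n
    _ ≤ (c + 1) * K * Real.exp (n * (χ + ε)) := by
        rw [mul_assoc]
        gcongr
        linarith

lemma ExpUpper.add (hx : ExpUpper x χ) (hy : ExpUpper y χ) :
    ExpUpper (fun n => x n + y n) χ := by
  intro ε hε
  obtain ⟨K, hK, hb⟩ := hx ε hε
  obtain ⟨K', hK', hb'⟩ := hy ε hε
  exact ⟨K + K', add_pos hK hK', fun n => by rw [add_mul]; exact add_le_add (hb n) (hb' n)⟩

lemma ExpUpper.sum {ι : Type*} {s : Finset ι} {x : ι → ℕ → ℝ}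
    (hx : ∀ i ∈ s, ExpUpper (x i) χ) : ExpUpper (fun n => ∑ i ∈ s, x i n) χ := by
  classical
  induction s using Finset.induction_on with
  | empty =>
    intro ε hε
    exact ⟨1, one_pos, fun n => by simp; positivity⟩
  | insert a s ha ih =>
    simp_rw [Finset.sum_insert ha]
    exact (hx a (Finset.mem_insert_self a s)).add
      (ih fun i hi => hx i (Finset.mem_insert_of_mem hi))

lemma ExpUpper.succ (hx : ExpUpper x χ) : ExpUpper (fun n => x (n + 1)) χ := by
  intro ε hε
  obtain ⟨K, hK, hb⟩ := hx ε hε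
  refine ⟨K * Real.exp (χ + ε), by positivity, fun n => (hb (n + 1)).trans (le_of_eq ?_)⟩
  rw [mul_assoc, ← Real.exp_add]
  push_cast
  congr 2
  ring

lemma ExpUpper.sum_range (hx : ExpUpper x χ) (hχ : 0 ≤ χ) :
    ExpUpper (fun n => ∑ i ∈ Finset.range n, x i) χ := by
  intro ε hε
  obtain ⟨K, hK, hb⟩ := hx (ε / 2) (half_pos hε)
  refine ⟨K * (2 / ε), by positivity, fun n => ?_⟩
  have hn : (n : ℝ) ≤ 2 / ε * Real.exp (n * (ε / 2)) := by
    have h := Real.add_one_le_exp ((n : ℝ) * (ε / 2))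
    calc (n : ℝ) = 2 / ε * (n * (ε / 2)) := by field_simp
      _ ≤ 2 / ε * Real.exp (n * (ε / 2)) := by gcongr; linarith
  calc ∑ i ∈ Finset.range n, x i
      ≤ ∑ _i ∈ Finset.range n, K * Real.exp (n * (χ + ε / 2)) := by
        refine Finset.sum_le_sum fun i hi => (hb i).trans ?_
        have : (i : ℝ) ≤ n := by exact_mod_cast (Finset.mem_range.1 hi).le
        gcongr
    _ = n * (K * Real.exp (n * (χ + ε / 2))) := by simp
    _ ≤ 2 / ε * Real.exp (n * (ε / 2)) * (K * Real.exp (n * (χ + ε / 2))) := by gcongr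
    _ = K * (2 / ε) * Real.exp (n * (χ + ε)) := by
        rw [mul_mul_mul_comm, ← Real.exp_add, mul_comm (2 / ε) K]
        congr 2
        ring

lemma expUpper_of_tendsto (hx : ∀ n, 0 < x n)
    (h : Tendsto (fun n : ℕ => 1 / (n : ℝ) * Real.log (x n)) atTop (𝓝 χ)) : ExpUpper x χ := by
  intro ε hε
  have hev : ∀ᶠ n : ℕ in atTop, x n / Real.exp (n * (χ + ε)) ≤ 1 := by
    filter_upwards [h.eventually_lt_const (lt_add_of_pos_right χ hε), eventually_gt_atTop 0]
      with n hn hn0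
    have hn' : (0 : ℝ) < n := by exact_mod_cast hn0
    rw [one_div, inv_mul_lt_iff₀ hn'] at hn
    rw [div_le_one (Real.exp_pos _), ← Real.log_le_iff_le_exp (hx n)]
    exact hn.le
  obtain ⟨K, hK⟩ := (IsBoundedUnder.bddAbove_range (f := fun n : ℕ =>
    x n / Real.exp (n * (χ + ε))) ⟨1, hev⟩)
  have hb (n : ℕ) : x n / Real.exp (n * (χ + ε)) ≤ K := hK ⟨n, rfl⟩
  refine ⟨K, lt_of_lt_of_le (div_pos (hx 0) (Real.exp_pos _)) (hb 0), fun n => ?_⟩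
  exact (div_le_iff₀ (Real.exp_pos _)).1 (hb n)

lemma ExpUpper.eventually_log_lt (hx : ∀ n, 0 < x n) (h : ExpUpper x χ) {a : ℝ} (ha : χ < a) :
    ∀ᶠ n : ℕ in atTop, 1 / (n : ℝ) * Real.log (x n) < a := by
  obtain ⟨K, hK, hb⟩ := h ((a - χ) / 2) (by linarith)
  have hlim : Tendsto (fun n : ℕ => Real.log K / (n : ℝ)) atTop (𝓝 0) :=
    tendsto_const_div_atTop_nhds_zero_nat _
  filter_upwards [hlim.eventually_lt_const (show 0 < (a - χ) / 2 by linarith),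
    eventually_gt_atTop 0] with n hn hn0
  have hn' : (0 : ℝ) < n := by exact_mod_cast hn0
  have h1 := Real.log_le_log (hx n) (hb n)
  rw [Real.log_mul hK.ne' (Real.exp_pos _).ne', Real.log_exp] at h1
  rw [div_lt_iff₀ hn'] at hn
  rw [one_div, inv_mul_lt_iff₀ hn']
  nlinarith

lemma tendsto_of_expUpper (hx : ∀ n, 0 < x n) (h : ExpUpper x χ)
    (h' : ExpUpper (fun n => (x n)⁻¹) (-χ)) :
    Tendsto (fun n : ℕ => 1 / (n : ℝ) * Real.log (x n)) atTop (𝓝 χ) := by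
  refine tendsto_order.2 ⟨fun a ha => ?_, fun a ha => h.eventually_log_lt hx ha⟩
  filter_upwards [h'.eventually_log_lt (fun n => inv_pos.2 (hx n)) (neg_lt_neg ha)] with n hn
  rw [Real.log_inv, mul_neg] at hn
  linarith

lemma expUpper_inv_of_tendsto (hx : ∀ n, 0 < x n)
    (h : Tendsto (fun n : ℕ => 1 / (n : ℝ) * Real.log (x n)) atTop (𝓝 χ)) :
    ExpUpper (fun n => (x n)⁻¹) (-χ) := by
  refine expUpper_of_tendsto (fun n => inv_pos.2 (hx n)) ?_
  simpa only [Real.log_inv, mul_neg] using h.neg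

end Growth

/-! ### Equidistribution of phases under multiplication by `L` -/

section Equidistribution

open ConstLengthSubst

lemma phase_eq_toCircle (k : ℝ) :
    phase k = (AddCircle.toCircle (k : UnitAddCircle) : ℂ) := by
  rw [phase, AddCircle.toCircle_apply_mk, Circle.coe_exp]
  congr 1
  push_cast
  ring

lemma norm_phase (k : ℝ) : ‖phase k‖ = 1 := by
  rw [phase_eq_toCircle, Circle.norm_coe]

lemma phase_eq_circleMap (k : ℝ) : phase k = circleMap 0 1 (2 * Real.pi * k) := by
  rw [phase, circleMap_zero]
  push_cast
  rw [one_mul]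
  congr 1
  ring

/-- A property that holds almost everywhere on the circle `ℝ / ℤ` holds at almost every real
number. -/
lemma ae_real_of_ae_unitAddCircle {P : UnitAddCircle → Prop} (h : ∀ᵐ x, P x) :
    ∀ᵐ k : ℝ, P (k : UnitAddCircle) := by
  have hn (n : ℤ) : ∀ᵐ k : ℝ ∂volume.restrict (Set.Ioc (n : ℝ) (n + 1)), P (k : UnitAddCircle) :=
    (UnitAddCircle.measurePreserving_mk n).quasiMeasurePreserving.ae h
  have hU : ⋃ n : ℤ, Set.Ioc (n : ℝ) (n + 1) = Set.univ := iUnion_Ioc_intCast ℝ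
  rw [← Measure.restrict_univ (μ := (volume : Measure ℝ)), ← hU, ae_restrict_iUnion_iff]
  exact hn

lemma integral_log_norm_eval_toCircle (p : ℂ[X]) :
    ∫ x : UnitAddCircle, Real.log ‖p.eval (AddCircle.toCircle x : ℂ)‖ = p.logMahlerMeasure := by
  rw [← UnitAddCircle.intervalIntegral_preimage 0, logMahlerMeasure_def,
    Real.circleAverage_def]
  have h := intervalIntegral.smul_integral_comp_mul_left (a := 0) (b := 1)
    (fun θ => Real.log ‖p.eval (circleMap 0 1 θ)‖) (2 * Real.pi)
  rw [mul_zero, mul_one] at h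
  rw [← h, smul_smul, inv_mul_cancel₀ (by positivity), one_smul, zero_add]
  simp_rw [← phase_eq_toCircle, phase_eq_circleMap]

lemma measurable_log_norm_eval_toCircle (p : ℂ[X]) :
    Measurable fun x : UnitAddCircle => Real.log ‖p.eval (AddCircle.toCircle x : ℂ)‖ := by
  have : Continuous fun x : UnitAddCircle => ‖p.eval (AddCircle.toCircle x : ℂ)‖ := by
    have := AddCircle.continuous_toCircle (T := 1)
    fun_prop
  exact Real.measurable_log.comp this.measurable

lemma integrable_log_norm_eval_toCircle (p : ℂ[X]) :
    Integrable fun x : UnitAddCircle => Real.log ‖p.eval (AddCircle.toCircle x : ℂ)‖ := by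
  rw [← (UnitAddCircle.measurePreserving_mk 0).integrable_comp
    (measurable_log_norm_eval_toCircle p).aestronglyMeasurable]
  have h := p.intervalIntegrable_mahlerMeasure.comp_mul_left (c := 2 * Real.pi)
  rw [zero_div, div_self (by positivity), intervalIntegrable_iff_integrableOn_Ioc_of_le
    zero_le_one] at h
  simpa only [Function.comp_def, ← phase_eq_toCircle, phase_eq_circleMap, zero_add,
    IntegrableOn] using h

lemma ae_eval_toCircle_ne_zero {p : ℂ[X]} (hp : p ≠ 0) :
    ∀ᵐ x : UnitAddCircle, p.eval (AddCircle.toCircle x : ℂ) ≠ 0 := by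
  have hfin : {x : UnitAddCircle | p.eval (AddCircle.toCircle x : ℂ) = 0}.Finite := by
    have hinj : Function.Injective fun x : UnitAddCircle => (AddCircle.toCircle x : ℂ) :=
      Subtype.val_injective.comp (AddCircle.injective_toCircle one_ne_zero)
    refine (p.roots.finite_toSet.preimage hinj.injOn).subset fun x hx => ?_
    exact (mem_roots hp).2 hx
  have : Nontrivial (Set.Ico (0 : ℝ) (0 + 1)) := (Set.nontrivial_coe_sort).2
    ⟨0, by norm_num, 1 / 2, by norm_num, by norm_num⟩
  have : Nontrivial UnitAddCircle := (AddCircle.equivIco 1 0).nontrivial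
  exact measure_mono_null (fun x hx => by simpa using hx) (hfin.measure_zero volume)

lemma smul_iterate_unitAddCircle (L n : ℕ) (k : ℝ) :
    (fun x : UnitAddCircle => L • x)^[n] (k : UnitAddCircle)
      = (((L : ℝ) ^ n * k : ℝ) : UnitAddCircle) := by
  induction n with
  | zero => simp
  | succ n ih =>
    rw [Function.iterate_succ_apply', ih, ← AddCircle.coe_nsmul, nsmul_eq_mul, pow_succ',
      mul_assoc]

lemma ae_forall_iterate {Ω : Type*} [MeasurableSpace Ω] {μ : Measure Ω} {T : Ω → Ω}
    (hT : MeasurePreserving T μ μ) {P : Ω → Prop} (h : ∀ᵐ x ∂μ, P x) :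
    ∀ᵐ x ∂μ, ∀ n : ℕ, P (T^[n] x) :=
  ae_all_iff.2 fun n => (hT.iterate n).quasiMeasurePreserving.ae h

/-- Birkhoff's theorem for the ergodic map `k ↦ L k` on `ℝ / ℤ` and the function
`k ↦ log |p (exp (2πik))|`, together with the nonvanishing of `p` along almost every orbit. -/
theorem ae_tendsto_log_prod_eval_phase {L : ℕ} (hL : 2 ≤ L) {p : ℂ[X]} (hp : p ≠ 0) :
    ∀ᵐ k : ℝ, (∀ n : ℕ, p.eval (phase ((L : ℝ) ^ n * k)) ≠ 0) ∧
      Tendsto (fun n : ℕ => 1 / (n : ℝ) *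
        Real.log ‖∏ i ∈ Finset.range n, p.eval (phase ((L : ℝ) ^ i * k))‖) atTop
        (𝓝 p.logMahlerMeasure) := by
  have : IsProbabilityMeasure (volume : Measure UnitAddCircle) :=
    ⟨UnitAddCircle.measure_univ⟩
  have herg : Ergodic (fun x : UnitAddCircle => L • x) volume :=
    AddCircle.ergodic_nsmul (by omega)
  have hB := herg.ae_tendsto_birkhoffSum (measurable_log_norm_eval_toCircle p)
    (integrable_log_norm_eval_toCircle p)
  rw [integral_log_norm_eval_toCircle] at hB
  have hZ := ae_forall_iterate herg.toMeasurePreserving (ae_eval_toCircle_ne_zero hp)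
  filter_upwards [ae_real_of_ae_unitAddCircle hB, ae_real_of_ae_unitAddCircle hZ] with k h1 h2
  simp only [smul_iterate_unitAddCircle, ← phase_eq_toCircle] at h2
  refine ⟨h2, h1.congr fun n => ?_⟩
  rw [norm_prod, Real.log_prod fun i _ => norm_ne_zero_iff.2 (h2 i)]
  simp only [birkhoffSum, smul_iterate_unitAddCircle, ← phase_eq_toCircle]

end Equidistribution

/-! ### Bounds for Mahler measures -/

section Mahler

lemma mahlerMeasure_sq_le_sum_range {p : ℂ[X]} {N : ℕ} (hp : p.degree < N) :
    p.mahlerMeasure ^ 2 ≤ ∑ n ∈ Finset.range N, ‖p.coeff n‖ ^ 2 := by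
  have h1 := p.mahlerMeasure_le_sqrt_sum_sq_norm_coeff
  have h2 : ∑ n ∈ p.support, ‖p.coeff n‖ ^ 2 ≤ ∑ n ∈ Finset.range N, ‖p.coeff n‖ ^ 2 := by
    refine Finset.sum_le_sum_of_subset_of_nonneg (fun n hn => ?_) fun _ _ _ => by positivity
    rw [Finset.mem_range]
    by_contra hN
    exact (mem_support_iff.1 hn) (coeff_eq_zero_of_degree_lt
      (hp.trans_le (by exact_mod_cast not_lt.1 hN)))
  exact ((Real.le_sqrt p.mahlerMeasure_nonneg (by positivity)).1 h1).trans h2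

/-- For a polynomial with `L` unimodular coefficients, Landau's inequality only gives `√L`.
Multiplying by `X ^ (L - 1) - a` with `|a| = 1 / L` does not decrease the Mahler measure, but makes
the two extreme coefficients of `p` interfere, which lowers the sum of the squared coefficients
to `L - 1 / L`. -/
lemma mahlerMeasure_sq_lt_of_norm_coeff_eq_one {p : ℂ[X]} {L : ℕ} (hL : 2 ≤ L)
    (hp : p.degree < L) (hc : ∀ n < L, ‖p.coeff n‖ = 1) : p.mahlerMeasure ^ 2 < L := by
  obtain ⟨d, rfl⟩ : ∃ d, L = d + 1 := ⟨L - 1, by omega⟩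
  set t : ℝ := 1 / (d + 1) with ht
  have ht0 : 0 < t := by positivity
  have hd : (d + 1 : ℝ) * t = 1 := by rw [ht]; field_simp
  have hd0 : p.coeff d ≠ 0 := norm_ne_zero_iff.1 (by rw [hc d (by omega)]; exact one_ne_zero)
  set a : ℂ := t * p.coeff 0 / p.coeff d with ha
  have han : ‖a‖ = t := by
    rw [ha, norm_div, norm_mul, hc 0 (by omega), hc d (by omega)]
    simp [ht0.le]
  have had : a * p.coeff d = t * p.coeff 0 := by rw [ha]; field_simp
  have hzero (n : ℕ) (hn : d < n) : p.coeff n = 0 :=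
    coeff_eq_zero_of_degree_lt (hp.trans_le (by exact_mod_cast hn))
  set q : ℂ[X] := X ^ d - C a with hq
  have hd1 : d ≠ 0 := by omega
  have hqM : 1 ≤ q.mahlerMeasure := by
    apply one_le_mahlerMeasure_of_one_le_norm_leadingCoeff
    rw [hq, leadingCoeff_X_pow_sub_C (by omega), norm_one]
  have hcoeff (n : ℕ) : (p * q).coeff n
      = (if d ≤ n then p.coeff (n - d) else 0) - p.coeff n * a := by
    rw [hq, mul_sub, coeff_sub, coeff_mul_X_pow', coeff_mul_C]
  have hdeg : (p * q).degree < ((d + 1 + d : ℕ) : WithBot ℕ) := by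
    rw [degree_lt_iff_coeff_zero]
    intro m hm
    rw [hcoeff, if_pos (by omega), hzero _ (by omega), hzero _ (by omega)]
    simp
  have h1 (n : ℕ) (hn : n ∈ Finset.range d) : ‖(p * q).coeff n‖ ^ 2 = t ^ 2 := by
    have hn' := Finset.mem_range.1 hn
    rw [hcoeff, if_neg (by omega), zero_sub, norm_neg, norm_mul, han, hc n (by omega), one_mul]
  have h2 : ‖(p * q).coeff d‖ ^ 2 = (1 - t) ^ 2 := by
    rw [hcoeff, if_pos le_rfl, Nat.sub_self, mul_comm, had,
      show p.coeff 0 - t * p.coeff 0 = ((1 - t : ℝ) : ℂ) * p.coeff 0 by push_cast; ring,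
      norm_mul, hc 0 (by omega), mul_one, Complex.norm_real, Real.norm_eq_abs, sq_abs]
  have h3 (n : ℕ) (hn : n ∈ Finset.range d) : ‖(p * q).coeff (d + 1 + n)‖ ^ 2 = 1 := by
    have hn' := Finset.mem_range.1 hn
    rw [hcoeff, if_pos (by omega), hzero (d + 1 + n) (by omega), zero_mul, sub_zero,
      hc _ (by omega), one_pow]
  have hsum : ∑ n ∈ Finset.range (d + 1 + d), ‖(p * q).coeff n‖ ^ 2 = (d + 1) - t := by
    rw [Finset.sum_range_add, Finset.sum_range_succ, Finset.sum_congr rfl h1, h2,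
      Finset.sum_congr rfl h3]
    simp only [Finset.sum_const, Finset.card_range, nsmul_eq_mul]
    linear_combination t * hd
  have hM := mahlerMeasure_sq_le_sum_range hdeg
  rw [hsum, mahlerMeasure_mul, mul_pow] at hM
  have : p.mahlerMeasure ^ 2 ≤ p.mahlerMeasure ^ 2 * q.mahlerMeasure ^ 2 :=
    le_mul_of_one_le_right (sq_nonneg _) (one_le_pow₀ hqM)
  push_cast
  linarith

/-- If the `L ≥ 2` coefficients of `p` are bounded by `1`, then its Mahler measure is strictly less
than `√L`. -/
lemma logMahlerMeasure_lt_log_sqrt {p : ℂ[X]} {L : ℕ} (hL : 2 ≤ L)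
    (hp : p.degree < L) (hc : ∀ n, ‖p.coeff n‖ ≤ 1) :
    p.logMahlerMeasure < Real.log (Real.sqrt L) := by
  have hL' : (1 : ℝ) < L := by exact_mod_cast (by omega : 1 < L)
  by_cases hp0 : p = 0
  · rw [hp0, logMahlerMeasure_zero]
    exact Real.log_pos (Real.lt_sqrt_of_sq_lt (by linarith))
  rw [logMahlerMeasure_eq_log_MahlerMeasure]
  refine Real.log_lt_log (mahlerMeasure_pos_of_ne_zero hp0) (Real.lt_sqrt_of_sq_lt ?_)
  by_cases h : ∀ n < L, ‖p.coeff n‖ = 1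
  · exact mahlerMeasure_sq_lt_of_norm_coeff_eq_one hL hp h
  push Not at h
  obtain ⟨m, hm, hne⟩ := h
  calc p.mahlerMeasure ^ 2 ≤ ∑ n ∈ Finset.range L, ‖p.coeff n‖ ^ 2 :=
        mahlerMeasure_sq_le_sum_range hp
    _ < ∑ _n ∈ Finset.range L, (1 : ℝ) := by
        refine Finset.sum_lt_sum (fun n _ => pow_le_one₀ (norm_nonneg _) (hc n))
          ⟨m, Finset.mem_range.2 hm, ?_⟩
        exact pow_lt_one₀ (norm_nonneg _) (lt_of_le_of_ne (hc m) hne) two_ne_zero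
    _ = L := by simp

lemma logMahlerMeasure_nonneg_of_norm_coeff {p : ℂ[X]}
    (hc : ∀ n, p.coeff n ≠ 0 → ‖p.coeff n‖ = 1) : 0 ≤ p.logMahlerMeasure := by
  by_cases hp0 : p = 0
  · rw [hp0, logMahlerMeasure_zero]
  rw [logMahlerMeasure_eq_log_MahlerMeasure]
  refine Real.log_nonneg (one_le_mahlerMeasure_of_one_le_norm_leadingCoeff (ge_of_eq ?_))
  exact hc _ (leadingCoeff_ne_zero.2 hp0)

lemma logMahlerMeasure_sum_range_X_pow (L : ℕ) :
    (∑ i ∈ Finset.range L, (X : ℂ[X]) ^ i).logMahlerMeasure = 0 := by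
  by_cases hL : L = 0
  · simp [hL]
  have h := congrArg logMahlerMeasure (geom_sum_mul (X : ℂ[X]) L)
  have hne : (X ^ L - 1 : ℂ[X]) ≠ 0 := by
    simpa using X_pow_sub_C_ne_zero (Nat.pos_of_ne_zero hL) (1 : ℂ)
  rw [logMahlerMeasure_mul_eq_add_logMahlerMeasure (by rw [geom_sum_mul]; exact hne)] at h
  have h1 : (X - 1 : ℂ[X]).logMahlerMeasure = 0 := by
    simpa using logMahlerMeasure_X_sub_C 1
  have h2 : (X ^ L - 1 : ℂ[X]).logMahlerMeasure = 0 := by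
    rw [logMahlerMeasure_eq_log_leadingCoeff_add_sum_log_roots]
    have hlc : (X ^ L - 1 : ℂ[X]).leadingCoeff = 1 := by
      simpa using leadingCoeff_X_pow_sub_C (Nat.pos_of_ne_zero hL) (r := (1 : ℂ))
    rw [hlc, norm_one, Real.log_one, zero_add]
    refine Multiset.sum_eq_zero fun y hy => ?_
    obtain ⟨z, hz, rfl⟩ := Multiset.mem_map.1 hy
    have hz1 : z ^ L = 1 := by
      have := (mem_roots hne).1 hz
      simpa [IsRoot, sub_eq_zero] using this
    rw [Complex.norm_eq_one_of_pow_eq_one hz1 hL]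
    simp [Real.posLog]
  linarith

end Mahler

/-! ### Common eigenvectors of commuting permutations -/

section CommonEigenvectors

variable {A : Type*} [Fintype A]

/-- The sum of the entries, as a linear functional; its kernel is the hyperplane on which constant
columns act as zero. -/
noncomputable def entrySum (A : Type*) [Fintype A] : (A → ℂ) →ₗ[ℂ] ℂ :=
  ∑ a, LinearMap.proj a

lemma entrySum_apply (v : A → ℂ) : entrySum A v = ∑ a, v a := by
  simp [entrySum]

lemma entrySum_comp_perm (σ : Equiv.Perm A) (v : A → ℂ) :
    entrySum A (v ∘ σ) = entrySum A v := by
  simp only [entrySum_apply]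
  exact Equiv.sum_comp σ v

lemma finrank_ker_entrySum [Nonempty A] :
    Module.finrank ℂ (LinearMap.ker (entrySum A)) = Fintype.card A - 1 := by
  classical
  have hsurj : LinearMap.range (entrySum A) = ⊤ := by
    refine LinearMap.range_eq_top.2 fun c => ⟨Pi.single (Classical.arbitrary A) c, ?_⟩
    simp [entrySum_apply]
  have h := LinearMap.finrank_range_add_finrank_ker (entrySum A)
  rw [hsurj, finrank_top, Module.finrank_self, Module.finrank_pi] at h
  omega

/-- The action of a permutation of coordinates on the hyperplane of vectors with entry sum zero. -/
noncomputable def permOnKer (σ : Equiv.Perm A) :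
    Module.End ℂ (LinearMap.ker (entrySum A)) :=
  (LinearMap.funLeft ℂ ℂ σ).restrict fun v hv => by
    rw [LinearMap.mem_ker] at hv ⊢
    exact (entrySum_comp_perm σ v).trans hv

lemma permOnKer_mul (σ τ : Equiv.Perm A) : permOnKer (σ * τ) = permOnKer τ * permOnKer σ := by
  ext v a
  rfl

lemma permOnKer_pow (σ : Equiv.Perm A) (n : ℕ) : permOnKer (σ ^ n) = permOnKer σ ^ n := by
  induction n with
  | zero => rfl
  | succ n ih => rw [pow_succ, permOnKer_mul, ih, pow_succ']

lemma isSemisimple_permOnKer (σ : Equiv.Perm A) : (permOnKer σ).IsSemisimple := by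
  have hpos : 0 < orderOf σ := orderOf_pos σ
  refine Module.End.isSemisimple_of_squarefree_aeval_eq_zero (p := X ^ orderOf σ - C (1 : ℂ)) ?_ ?_
  · exact (separable_X_pow_sub_C 1 (by exact_mod_cast hpos.ne') one_ne_zero).squarefree
  · have : permOnKer σ ^ orderOf σ = 1 := by
      rw [← permOnKer_pow, pow_orderOf_eq_one]
      rfl
    simp [this]

/-- Pairwise commuting permutations have a common eigenbasis in the hyperplane of vectors with entry
sum zero, with unimodular eigenvalues. -/
theorem exists_common_eigenbasis [Nonempty A] {ι : Type*} [Finite ι] (σ : ι → Equiv.Perm A)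
    (hσ : ∀ i j, Commute (σ i) (σ j)) :
    ∃ (b : Fin (Fintype.card A - 1) → A → ℂ) (χ : Fin (Fintype.card A - 1) → ι → ℂ),
      LinearIndependent ℂ b ∧ (∀ j, entrySum A (b j) = 0) ∧
      (∀ j i, b j ∘ σ i = χ j i • b j) ∧ ∀ j i, ‖χ j i‖ = 1 := by
  have htop : ⨆ χ : ι → ℂ, ⨅ i, (permOnKer (σ i)).eigenspace (χ i) = ⊤ := by
    have h :=
      Module.End.iSup_iInf_maxGenEigenspace_eq_top_of_iSup_maxGenEigenspace_eq_top_of_commute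
        (fun i => permOnKer (σ i)) (fun i j _ => by
          change permOnKer (σ i) * permOnKer (σ j) = permOnKer (σ j) * permOnKer (σ i)
          rw [← permOnKer_mul, ← permOnKer_mul, (hσ i j).eq])
        fun i => Module.End.iSup_maxGenEigenspace_eq_top _
    simpa only [(isSemisimple_permOnKer _).isFinitelySemisimple.maxGenEigenspace_eq_eigenspace]
      using h
  set S : Set (LinearMap.ker (entrySum A)) :=
    ⋃ χ : ι → ℂ, (⨅ i, (permOnKer (σ i)).eigenspace (χ i) : Submodule ℂ _) with hS
  have hspan : ⊤ ≤ Submodule.span ℂ S := by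
    rw [hS, Submodule.span_iUnion]
    simp only [Submodule.span_eq, htop, le_refl]
  set B := Module.Basis.ofSpan hspan
  set e := B.indexEquiv (Module.finBasisOfFinrankEq ℂ _ (finrank_ker_entrySum (A := A)))
  have hmem (j : Fin (Fintype.card A - 1)) : ∃ χ : ι → ℂ,
      ∀ i, permOnKer (σ i) (B (e.symm j)) = χ i • B (e.symm j) := by
    have h : B (e.symm j) ∈ S := Module.Basis.ofSpan_subset hspan ⟨_, rfl⟩
    simpa [hS, Module.End.mem_eigenspace_iff] using h
  choose χ hχ using hmem
  have heig (j : Fin (Fintype.card A - 1)) (i : ι) :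
      (B (e.symm j) : A → ℂ) ∘ σ i = χ j i • (B (e.symm j) : A → ℂ) :=
    congrArg Subtype.val (hχ j i)
  refine ⟨fun j => B (e.symm j), χ, ?_, fun j => LinearMap.mem_ker.1 (B (e.symm j)).2, heig,
    fun j i => ?_⟩
  · exact (B.linearIndependent.comp _ e.symm.injective).map'
      (LinearMap.ker (entrySum A)).subtype (Submodule.ker_subtype _)
  · -- a permutation preserves the sum of the absolute values of the entries
    have hne : (B (e.symm j) : A → ℂ) ≠ 0 := by
      simpa using B.ne_zero (e.symm j)
    have hpos : 0 < ∑ a, ‖(B (e.symm j) : A → ℂ) a‖ := by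
      obtain ⟨a, ha⟩ := Function.ne_iff.1 hne
      exact Finset.sum_pos' (fun _ _ => norm_nonneg _)
        ⟨a, Finset.mem_univ a, norm_pos_iff.2 ha⟩
    have h1 := Equiv.sum_comp (σ i) fun a => ‖(B (e.symm j) : A → ℂ) a‖
    have h2 (a : A) : ‖(B (e.symm j) : A → ℂ) (σ i a)‖
        = ‖χ j i‖ * ‖(B (e.symm j) : A → ℂ) a‖ := by
      rw [← norm_mul]
      exact congrArg norm (congrFun (heig j i) a)
    simp_rw [h2, ← Finset.mul_sum] at h1
    exact mul_right_cancel₀ hpos.ne' (h1.trans (one_mul _).symm)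

end CommonEigenvectors

/-! ### Column matrices, cocycle and outward iteration in an adapted basis -/

namespace ConstLengthSubst

variable {A : Type*} {L : ℕ} [DecidableEq A]

/-- The `0`-`1` matrix of the `t`-th column, acting on vectors by sending the basis vector of the
letter `j` to that of the letter `ϱ(j)_t`. -/
noncomputable def columnMatrix (ϱ : ConstLengthSubst A L) (t : Fin L) : Matrix A A ℂ :=
  Matrix.of fun i j => if ϱ j t = i then 1 else 0

lemma fourierMatrix_eq_sum (ϱ : ConstLengthSubst A L) (k : ℝ) :
    ϱ.fourierMatrix k = ∑ t : Fin L, phase k ^ (t : ℕ) • ϱ.columnMatrix t := by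
  ext i j
  simp [fourierMatrix, columnMatrix, Matrix.sum_apply, Finset.sum_filter]

lemma bijectivePart_eq_sum (ϱ : ConstLengthSubst A L) (k : ℝ) :
    ϱ.bijectivePart k
      = ∑ t with ϱ.BijectiveColumn t, phase k ^ (t : ℕ) • ϱ.columnMatrix t := by
  ext i j
  simp only [bijectivePart, columnMatrix, Matrix.sum_apply, Matrix.of_apply, Matrix.smul_apply,
    smul_eq_mul, mul_ite, mul_one, mul_zero]
  rw [Finset.sum_ite, Finset.sum_const_zero, add_zero, Finset.filter_filter]
  simp only [and_comm]

variable [Fintype A]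

lemma columnMatrix_mulVec_apply (ϱ : ConstLengthSubst A L) (t : Fin L) (v : A → ℂ) (i : A) :
    (ϱ.columnMatrix t).mulVec v i = ∑ j, if ϱ j t = i then v j else 0 := by
  simp [columnMatrix, Matrix.mulVec, dotProduct]

lemma columnMatrix_mulVec_of_constant (ϱ : ConstLengthSubst A L) {t : Fin L}
    (ht : ϱ.ConstantColumn t) {v : A → ℂ} (hv : entrySum A v = 0) :
    (ϱ.columnMatrix t).mulVec v = 0 := by
  obtain ⟨c, hc⟩ := ht
  ext i
  rw [columnMatrix_mulVec_apply]
  have hc' (j : A) : ϱ j t = c := hc j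
  rw [entrySum_apply] at hv
  by_cases h : c = i <;> simp [hc', h, hv]

lemma columnMatrix_mulVec_of_bijective (ϱ : ConstLengthSubst A L) {t : Fin L}
    (ht : ϱ.BijectiveColumn t) (v : A → ℂ) :
    (ϱ.columnMatrix t).mulVec v = v ∘ (Equiv.ofBijective _ ht).symm := by
  ext i
  rw [columnMatrix_mulVec_apply]
  have h (j : A) : ϱ j t = i ↔ j = (Equiv.ofBijective _ ht).symm i := by
    rw [Equiv.eq_symm_apply]
    rfl
  simp [h]

lemma entrySum_columnMatrix_mulVec (ϱ : ConstLengthSubst A L) (t : Fin L) (v : A → ℂ) :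
    entrySum A ((ϱ.columnMatrix t).mulVec v) = entrySum A v := by
  simp only [entrySum_apply, columnMatrix_mulVec_apply]
  rw [Finset.sum_comm]
  simp

lemma entrySum_fourierMatrix_mulVec (ϱ : ConstLengthSubst A L) (k : ℝ) (v : A → ℂ) :
    entrySum A ((ϱ.fourierMatrix k).mulVec v)
      = (∑ m ∈ Finset.range L, phase k ^ m) * entrySum A v := by
  rw [fourierMatrix_eq_sum, Matrix.sum_mulVec, map_sum]
  simp only [Matrix.smul_mulVec, map_smul, entrySum_columnMatrix_mulVec, smul_eq_mul]
  rw [← Finset.sum_mul, Fin.sum_univ_eq_sum_range (fun m => phase k ^ m) L]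

/-- The vectors `b j` span the hyperplane of vectors with entry sum zero and diagonalize all column
matrices on it; constant columns act as zero. -/
theorem exists_column_eigenbasis [Nonempty A] (ϱ : ConstLengthSubst A L)
    (hcol : ∀ m, ϱ.BijectiveColumn m ∨ ϱ.ConstantColumn m)
    (hab : ∀ g ∈ ϱ.columnGroup, ∀ h ∈ ϱ.columnGroup, g * h = h * g) :
    ∃ (b : Fin (Fintype.card A - 1) → A → ℂ) (c : Fin (Fintype.card A - 1) → Fin L → ℂ),
      LinearIndependent ℂ b ∧ (∀ j, entrySum A (b j) = 0) ∧
      (∀ j m, (ϱ.columnMatrix m).mulVec (b j) = c j m • b j) ∧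
      (∀ j m, ϱ.BijectiveColumn m → ‖c j m‖ = 1) ∧
      ∀ j m, ¬ ϱ.BijectiveColumn m → c j m = 0 := by
  obtain ⟨b, χ, hb, hb0, hχ, hχ1⟩ := exists_common_eigenbasis
    (fun m : {m // ϱ.BijectiveColumn m} => (Equiv.ofBijective _ m.2).symm) fun m m' => by
      have hmem (m : {m // ϱ.BijectiveColumn m}) :
          (Equiv.ofBijective _ m.2 : Equiv.Perm A) ∈ ϱ.columnGroup :=
        Subgroup.subset_closure ⟨m, rfl⟩
      have h : Commute (Equiv.ofBijective _ m.2 : Equiv.Perm A) (Equiv.ofBijective _ m'.2) :=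
        hab _ (hmem m) _ (hmem m')
      exact h.inv_inv
  refine ⟨b, fun j m => if h : ϱ.BijectiveColumn m then χ j ⟨m, h⟩ else 0, hb, hb0,
    fun j m => ?_, fun j m h => ?_, fun j m h => dif_neg h⟩
  · beta_reduce
    by_cases h : ϱ.BijectiveColumn m
    · rw [dif_pos h, ← hχ, columnMatrix_mulVec_of_bijective ϱ h]
    · rw [dif_neg h, zero_smul,
        columnMatrix_mulVec_of_constant ϱ ((hcol m).resolve_left h) (hb0 j)]
  · beta_reduce
    rw [dif_pos h]
    exact hχ1 j _

end ConstLengthSubst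

section Triangular

/-- Vectors spanning the hyperplane of entry sum zero, completed by the vector of ones to a basis
of the whole space. -/
lemma exists_basis_extend_ones {A : Type*} [Fintype A] [Nonempty A]
    {b : Fin (Fintype.card A - 1) → A → ℂ}
    (hb : LinearIndependent ℂ b) (hb0 : ∀ j, entrySum A (b j) = 0) :
    ∃ bas : Module.Basis (Fin (Fintype.card A - 1) ⊕ Unit) ℂ (A → ℂ),
      (∀ j, bas (Sum.inl j) = b j) ∧ bas (Sum.inr ()) = 1 := by
  have hcard : (Fintype.card A : ℂ) ≠ 0 := by exact_mod_cast Fintype.card_ne_zero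
  have hker : Submodule.span ℂ (Set.range b) ≤ LinearMap.ker (entrySum A) := by
    rw [Submodule.span_le]
    rintro _ ⟨j, rfl⟩
    exact hb0 j
  have hli : LinearIndependent ℂ (Sum.elim b fun _ : Unit => (1 : A → ℂ)) := by
    refine hb.sum_type (LinearIndependent.of_subsingleton () one_ne_zero) ?_
    rw [Submodule.disjoint_def]
    intro v hv hv'
    rw [Set.range_const, Submodule.mem_span_singleton] at hv'
    obtain ⟨a, rfl⟩ := hv'
    have h : entrySum A (a • (1 : A → ℂ)) = 0 := hker hv
    rw [map_smul, entrySum_apply] at h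
    have ha : a = 0 := by simpa using h
    rw [ha, zero_smul]
  have hfin : Fintype.card (Fin (Fintype.card A - 1) ⊕ Unit) = Module.finrank ℂ (A → ℂ) := by
    have := Fintype.card_pos (α := A)
    simp
    omega
  refine ⟨basisOfLinearIndependentOfCardEqFinrank hli hfin, fun j => ?_, ?_⟩ <;> simp

variable {A J : Type*} [Fintype A] [DecidableEq A] [Fintype J]

/-- The characteristic polynomial of a matrix that is diagonal on all but one vector of a basis. -/
lemma charpoly_of_almost_diagonal (M : Matrix A A ℂ) (bas : Module.Basis (J ⊕ Unit) ℂ (A → ℂ))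
    {d h : J → ℂ} {s : ℂ} (hd : ∀ j, M.mulVec (bas (Sum.inl j)) = d j • bas (Sum.inl j))
    (hs : M.mulVec (bas (Sum.inr ())) = s • bas (Sum.inr ()) + ∑ j, h j • bas (Sum.inl j)) :
    M.charpoly = (X - C s) * ∏ j, (X - C (d j)) := by
  classical
  have hmat : LinearMap.toMatrix bas bas (Matrix.toLin' M)
      = Matrix.fromBlocks (Matrix.diagonal d) (Matrix.of fun j _ => h j) 0
          (Matrix.diagonal fun _ => s) := by
    ext i j
    rcases j with j | j
    · rw [LinearMap.toMatrix_apply, Matrix.toLin'_apply, hd]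
      rcases i with i | i
      · by_cases hij : i = j
        · simp [hij]
        · simp [hij]
      · simp
    · rw [LinearMap.toMatrix_apply, Matrix.toLin'_apply, hs]
      rcases i with i | i
      · simp [Finsupp.single_apply]
      · simp
  rw [← Matrix.charpoly_toLin', ← LinearMap.charpoly_toMatrix _ bas, hmat,
    Matrix.charpoly_fromBlocks_zero₂₁, Matrix.charpoly_diagonal, Matrix.charpoly_diagonal, mul_comm]
  simp

lemma det_ne_zero_of_charpoly_eq {M : Matrix A A ℂ} {d : J → ℂ} {s : ℂ}
    (h : M.charpoly = (X - C s) * ∏ j, (X - C (d j))) (hs : s ≠ 0) (hd : ∀ j, d j ≠ 0) :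
    M.det ≠ 0 := by
  rw [Matrix.det_eq_sign_charpoly_coeff, h, coeff_zero_eq_eval_zero, eval_mul, eval_prod]
  simp [hs, Finset.prod_ne_zero_iff, hd]

end Triangular

namespace ConstLengthSubst

variable {A J : Type*} {L : ℕ} [DecidableEq A] [Fintype A] [Fintype J]

lemma cocycle_succ_right (ϱ : ConstLengthSubst A L) (n : ℕ) (k : ℝ) :
    ϱ.cocycle (n + 1) k = ϱ.cocycle n k * ϱ.fourierMatrix ((L : ℝ) ^ n * k) := by
  induction n generalizing k with
  | zero => simp [cocycle]
  | succ n ih =>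
    rw [cocycle, ih, cocycle, Matrix.mul_assoc, pow_succ, mul_assoc]

lemma outward_eq (ϱ : ConstLengthSubst A L) (n : ℕ) (k : ℝ) :
    ϱ.outward n k = ((Real.sqrt L : ℝ) : ℂ) ^ n • (ϱ.cocycle n k)⁻¹ := by
  induction n with
  | zero => simp [outward, cocycle]
  | succ n ih =>
    rw [outward, ih, cocycle_succ_right, Matrix.mul_inv_rev, Matrix.mul_smul, smul_smul, pow_succ']

lemma det_cocycle_ne_zero (ϱ : ConstLengthSubst A L) {k : ℝ}
    (h : ∀ n : ℕ, (ϱ.fourierMatrix ((L : ℝ) ^ n * k)).det ≠ 0) (n : ℕ) :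
    (ϱ.cocycle n k).det ≠ 0 := by
  induction n with
  | zero => simp [cocycle]
  | succ n ih =>
    rw [cocycle_succ_right, Matrix.det_mul]
    exact mul_ne_zero ih (h n)

/-- The product `p(u) p(u^L) ⋯ p(u^(L^(n-1)))` of the values of `p` along the orbit of `k`, where
`u` is the phase of `k`. -/
noncomputable def orbitProd (L : ℕ) (p : ℂ[X]) (n : ℕ) (k : ℝ) : ℂ :=
  ∏ i ∈ Finset.range n, p.eval (phase ((L : ℝ) ^ i * k))

lemma orbitProd_succ (L : ℕ) (p : ℂ[X]) (n : ℕ) (k : ℝ) :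
    orbitProd L p (n + 1) k = orbitProd L p n k * p.eval (phase ((L : ℝ) ^ n * k)) :=
  Finset.prod_range_succ _ _

/-- The geometric sum `1 + X + ⋯ + X ^ (L - 1)`, giving the eigenvalue of the Fourier matrix that is
not inherited from the bijective part. -/
noncomputable def geomPoly (L : ℕ) : ℂ[X] := ∑ i ∈ Finset.range L, X ^ i

lemma geomPoly_eval (L : ℕ) (u : ℂ) : (geomPoly L).eval u = ∑ i ∈ Finset.range L, u ^ i := by
  simp [geomPoly, eval_finsetSum]

/-- Relative to the factor `orbitProd L (geomPoly L) n k`, the component in direction of the `j`-th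
eigenvector that the cocycle produces from the vector of ones; here `h j` is the corresponding
off-diagonal entry of the Fourier matrix. -/
noncomputable def shear (L : ℕ) (p : ℂ[X]) (h : ℝ → ℂ) (n : ℕ) (k : ℝ) : ℂ :=
  ∑ i ∈ Finset.range n,
    h ((L : ℝ) ^ i * k) * orbitProd L p i k / orbitProd L (geomPoly L) (i + 1) k

variable {ϱ : ConstLengthSubst A L} {bas : Module.Basis (J ⊕ Unit) ℂ (A → ℂ)} {β : J → ℂ[X]}
  {h : J → ℝ → ℂ}

lemma cocycle_mulVec_eigenvector {v : A → ℂ} {p : ℂ[X]}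
    (hv : ∀ k, (ϱ.fourierMatrix k).mulVec v = p.eval (phase k) • v) (n : ℕ) (k : ℝ) :
    (ϱ.cocycle n k).mulVec v = orbitProd L p n k • v := by
  induction n with
  | zero => simp [cocycle, orbitProd]
  | succ n ih =>
    rw [cocycle_succ_right, ← Matrix.mulVec_mulVec, hv, Matrix.mulVec_smul, ih, smul_smul,
      orbitProd_succ, mul_comm]

lemma cocycle_mulVec_inr
    (hβ : ∀ j k, (ϱ.fourierMatrix k).mulVec (bas (Sum.inl j))
      = (β j).eval (phase k) • bas (Sum.inl j))
    (hs : ∀ k, (ϱ.fourierMatrix k).mulVec (bas (Sum.inr ()))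
      = (geomPoly L).eval (phase k) • bas (Sum.inr ()) + ∑ j, h j k • bas (Sum.inl j))
    {k : ℝ} (hS : ∀ n, orbitProd L (geomPoly L) n k ≠ 0) (n : ℕ) :
    (ϱ.cocycle n k).mulVec (bas (Sum.inr ())) = orbitProd L (geomPoly L) n k •
      (bas (Sum.inr ()) + ∑ j, shear L (β j) (h j) n k • bas (Sum.inl j)) := by
  induction n with
  | zero => simp [cocycle, orbitProd, shear]
  | succ n ih =>
    have hstep (j : J) : orbitProd L (geomPoly L) (n + 1) k * shear L (β j) (h j) (n + 1) k
        = (geomPoly L).eval (phase ((L : ℝ) ^ n * k)) *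
            (orbitProd L (geomPoly L) n k * shear L (β j) (h j) n k)
          + h j ((L : ℝ) ^ n * k) * orbitProd L (β j) n k := by
      rw [shear, Finset.sum_range_succ, mul_add, mul_div_cancel₀ _ (hS (n + 1)), ← shear,
        orbitProd_succ]
      ring
    rw [cocycle_succ_right, ← Matrix.mulVec_mulVec, hs, Matrix.mulVec_add, Matrix.mulVec_smul, ih,
      Matrix.mulVec_sum]
    simp only [Matrix.mulVec_smul, cocycle_mulVec_eigenvector (hβ _), smul_add, Finset.smul_sum,
      smul_smul, hstep, add_smul, Finset.sum_add_distrib]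
    rw [orbitProd_succ, mul_comm (orbitProd L (geomPoly L) n k), add_assoc]

lemma repr_sum_inl_add_inr {V : Type*} [AddCommGroup V] [Module ℂ V]
    (bas : Module.Basis (J ⊕ Unit) ℂ V) (x : J → ℂ) (y : ℂ) :
    (∀ j, bas.repr (∑ j, x j • bas (Sum.inl j) + y • bas (Sum.inr ())) (Sum.inl j) = x j) ∧
    bas.repr (∑ j, x j • bas (Sum.inl j) + y • bas (Sum.inr ())) (Sum.inr ()) = y := by
  classical
  constructor
  · intro j
    simp [Finsupp.single_apply]
  · simp

lemma repr_cocycle_mulVec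
    (hβ : ∀ j k, (ϱ.fourierMatrix k).mulVec (bas (Sum.inl j))
      = (β j).eval (phase k) • bas (Sum.inl j))
    (hs : ∀ k, (ϱ.fourierMatrix k).mulVec (bas (Sum.inr ()))
      = (geomPoly L).eval (phase k) • bas (Sum.inr ()) + ∑ j, h j k • bas (Sum.inl j))
    {k : ℝ} (hS : ∀ n, orbitProd L (geomPoly L) n k ≠ 0) (n : ℕ) (v : A → ℂ) :
    (∀ j, bas.repr ((ϱ.cocycle n k).mulVec v) (Sum.inl j)
      = orbitProd L (β j) n k * bas.repr v (Sum.inl j)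
        + orbitProd L (geomPoly L) n k * shear L (β j) (h j) n k * bas.repr v (Sum.inr ())) ∧
    bas.repr ((ϱ.cocycle n k).mulVec v) (Sum.inr ())
      = orbitProd L (geomPoly L) n k * bas.repr v (Sum.inr ()) := by
  have hv : (ϱ.cocycle n k).mulVec v
      = ∑ j, (orbitProd L (β j) n k * bas.repr v (Sum.inl j)
        + orbitProd L (geomPoly L) n k * shear L (β j) (h j) n k * bas.repr v (Sum.inr ())) •
          bas (Sum.inl j)
        + (orbitProd L (geomPoly L) n k * bas.repr v (Sum.inr ())) • bas (Sum.inr ()) := by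
    conv_lhs => rw [← bas.sum_repr v, Fintype.sum_sum_type]
    simp only [Finset.univ_unique, PUnit.default_eq_unit, Finset.sum_singleton, Matrix.mulVec_add,
      Matrix.mulVec_sum, Matrix.mulVec_smul, cocycle_mulVec_eigenvector (hβ _),
      cocycle_mulVec_inr hβ hs hS, smul_add, Finset.smul_sum, smul_smul, add_smul,
      Finset.sum_add_distrib]
    rw [add_assoc, add_comm (Finset.sum _ _) (_ • bas (Sum.inr ()))]
    simp only [mul_comm]
  rw [hv]
  exact repr_sum_inl_add_inr bas _ _

lemma repr_cocycle_inv_mulVec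
    (hβ : ∀ j k, (ϱ.fourierMatrix k).mulVec (bas (Sum.inl j))
      = (β j).eval (phase k) • bas (Sum.inl j))
    (hs : ∀ k, (ϱ.fourierMatrix k).mulVec (bas (Sum.inr ()))
      = (geomPoly L).eval (phase k) • bas (Sum.inr ()) + ∑ j, h j k • bas (Sum.inl j))
    {k : ℝ} (hS : ∀ n, orbitProd L (geomPoly L) n k ≠ 0)
    (hD : ∀ j n, orbitProd L (β j) n k ≠ 0) (n : ℕ) (hdet : (ϱ.cocycle n k).det ≠ 0)
    (v : A → ℂ) :
    (∀ j, bas.repr (((ϱ.cocycle n k)⁻¹).mulVec v) (Sum.inl j)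
      = (bas.repr v (Sum.inl j) - shear L (β j) (h j) n k * bas.repr v (Sum.inr ()))
        * (orbitProd L (β j) n k)⁻¹) ∧
    bas.repr (((ϱ.cocycle n k)⁻¹).mulVec v) (Sum.inr ())
      = bas.repr v (Sum.inr ()) * (orbitProd L (geomPoly L) n k)⁻¹ := by
  have hinv : (ϱ.cocycle n k).mulVec (((ϱ.cocycle n k)⁻¹).mulVec v) = v := by
    rw [Matrix.mulVec_mulVec, Matrix.mul_nonsing_inv _ (isUnit_iff_ne_zero.2 hdet),
      Matrix.one_mulVec]
  obtain ⟨h1, h2⟩ := repr_cocycle_mulVec hβ hs hS n (((ϱ.cocycle n k)⁻¹).mulVec v)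
  rw [hinv] at h2
  simp only [hinv] at h1
  constructor
  · intro j
    rw [h1, h2, eq_mul_inv_iff_mul_eq₀ (hD j n)]
    ring
  · rw [h2, eq_mul_inv_iff_mul_eq₀ (hS n)]
    ring

end ConstLengthSubst

/-! ### Lyapunov exponents at regular points -/

section NormBounds

variable {V κ : Type*} [NormedAddCommGroup V] [NormedSpace ℂ V] [Fintype κ] {x : ℕ → V} {χ : ℝ}

lemma exists_norm_repr_le (bas : Module.Basis κ ℂ V) (i : κ) :
    ∃ K > 0, ∀ v, ‖bas.repr v i‖ ≤ K * ‖v‖ := by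
  have : FiniteDimensional ℂ V := bas.finiteDimensional_of_finite
  refine ⟨‖LinearMap.toContinuousLinearMap (bas.coord i)‖ + 1, by positivity, fun v => ?_⟩
  refine ((LinearMap.toContinuousLinearMap (bas.coord i)).le_opNorm v).trans ?_
  gcongr
  linarith

lemma expUpper_norm_of_repr (bas : Module.Basis κ ℂ V)
    (h : ∀ i, ExpUpper (fun n => ‖bas.repr (x n) i‖) χ) : ExpUpper (fun n => ‖x n‖) χ := by
  have hsum := ExpUpper.sum (s := Finset.univ) fun i _ => (h i).const_mul (norm_nonneg (bas i))
  refine hsum.mono fun n => ?_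
  conv_lhs => rw [← bas.sum_repr (x n)]
  refine (norm_sum_le _ _).trans (le_of_eq (Finset.sum_congr rfl fun i _ => ?_))
  rw [norm_smul, mul_comm]

lemma expUpper_inv_norm_of_repr (bas : Module.Basis κ ℂ V) (i : κ)
    (hne : ∀ n, bas.repr (x n) i ≠ 0)
    (h : ExpUpper (fun n => ‖bas.repr (x n) i‖⁻¹) χ) : ExpUpper (fun n => ‖x n‖⁻¹) χ := by
  obtain ⟨K, hK, hb⟩ := exists_norm_repr_le bas i
  refine (h.const_mul hK.le).mono fun n => ?_
  have hx : x n ≠ 0 := fun h0 => hne n (by rw [h0]; simp)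
  rw [← div_eq_mul_inv, le_div_iff₀ (norm_pos_iff.2 (hne n)), inv_mul_le_iff₀ (norm_pos_iff.2 hx),
    mul_comm]
  exact hb (x n)

end NormBounds

namespace ConstLengthSubst

variable {A J : Type*} {L : ℕ}

/-- Along the orbit of `k` under multiplication by `L`, the polynomial `p` has no zeros, and the
products of its absolute values have its logarithmic Mahler measure as exponential rate. -/
def OrbitRegular (L : ℕ) (p : ℂ[X]) (k : ℝ) : Prop :=
  (∀ n : ℕ, p.eval (phase ((L : ℝ) ^ n * k)) ≠ 0) ∧
    Tendsto (fun n : ℕ => 1 / (n : ℝ) * Real.log ‖orbitProd L p n k‖) atTop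
      (𝓝 p.logMahlerMeasure)

lemma ae_orbitRegular (hL : 2 ≤ L) {p : ℂ[X]} (hp : p ≠ 0) : ∀ᵐ k : ℝ, OrbitRegular L p k :=
  ae_tendsto_log_prod_eval_phase hL hp

lemma OrbitRegular.orbitProd_ne_zero {p : ℂ[X]} {k : ℝ} (hp : OrbitRegular L p k) (n : ℕ) :
    orbitProd L p n k ≠ 0 :=
  Finset.prod_ne_zero_iff.2 fun i _ => hp.1 i

lemma OrbitRegular.expUpper {p : ℂ[X]} {k : ℝ} (hp : OrbitRegular L p k) :
    ExpUpper (fun n => ‖orbitProd L p n k‖) p.logMahlerMeasure :=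
  expUpper_of_tendsto (fun n => norm_pos_iff.2 (hp.orbitProd_ne_zero n)) hp.2

lemma OrbitRegular.expUpper_inv {p : ℂ[X]} {k : ℝ} (hp : OrbitRegular L p k) :
    ExpUpper (fun n => ‖orbitProd L p n k‖⁻¹) (-p.logMahlerMeasure) :=
  expUpper_inv_of_tendsto (fun n => norm_pos_iff.2 (hp.orbitProd_ne_zero n)) hp.2

/-- The products of the zero polynomial vanish except for the empty one, which is `1`; so their rate
is at most `0`, in accordance with the convention `logMahlerMeasure 0 = 0`. -/
lemma expUpper_orbitProd_zero (L : ℕ) (k : ℝ) :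
    ExpUpper (fun n => ‖orbitProd L 0 n k‖) 0 := by
  refine (expUpper_const 1).mono fun n => ?_
  rw [orbitProd, norm_prod]
  exact Finset.prod_le_one (fun _ _ => norm_nonneg _) fun _ _ => by simp

lemma logMahlerMeasure_geomPoly (L : ℕ) : (geomPoly L).logMahlerMeasure = 0 :=
  logMahlerMeasure_sum_range_X_pow L

lemma geomPoly_ne_zero (hL : 0 < L) : geomPoly L ≠ 0 := by
  intro h
  have h1 := geomPoly_eval L 1
  rw [h] at h1
  simp only [eval_zero, one_pow, Finset.sum_const, Finset.card_range, nsmul_eq_mul, mul_one] at h1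
  exact hL.ne (by exact_mod_cast h1)

lemma expUpper_shear {p : ℂ[X]} {h : ℝ → ℂ} {H c : ℝ} {k : ℝ} (hS : OrbitRegular L (geomPoly L) k)
    (hH : ∀ k, ‖h k‖ ≤ H) (hp : ExpUpper (fun n => ‖orbitProd L p n k‖) c) (hc : 0 ≤ c) :
    ExpUpper (fun n => ‖shear L p h n k‖) c := by
  have hH0 : 0 ≤ H := (norm_nonneg _).trans (hH 0)
  have hS' := hS.expUpper_inv.succ
  rw [logMahlerMeasure_geomPoly, neg_zero] at hS'
  have hterm := (hp.mul hS' fun n => by positivity).const_mul hH0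
  rw [add_zero] at hterm
  refine (hterm.sum_range hc).mono fun n => (norm_sum_le _ _).trans ?_
  refine Finset.sum_le_sum fun i _ => ?_
  rw [norm_div, norm_mul, div_eq_mul_inv, mul_assoc]
  gcongr
  exact hH _

variable [DecidableEq A] [Fintype A] [Fintype J]
  {ϱ : ConstLengthSubst A L} {bas : Module.Basis (J ⊕ Unit) ℂ (A → ℂ)} {β : J → ℂ[X]}
  {h : J → ℝ → ℂ} {H : ℝ}

lemma hasLyapunovExponent_of_tendsto_cocycle_inv (hL : 0 < L) {k χ : ℝ} {v : A → ℂ}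
    (hv : ∀ n, (ϱ.cocycle n k)⁻¹.mulVec v ≠ 0)
    (hlim : Tendsto (fun n : ℕ => 1 / (n : ℝ) * Real.log ‖(ϱ.cocycle n k)⁻¹.mulVec v‖) atTop
      (𝓝 χ)) :
    ϱ.HasLyapunovExponent k v (Real.log (Real.sqrt L) + χ) := by
  refine (hlim.const_add (Real.log (Real.sqrt L))).congr' ?_
  filter_upwards [eventually_gt_atTop 0] with n hn
  have hn' : (n : ℝ) ≠ 0 := by exact_mod_cast hn.ne'
  have hL' : Real.sqrt L ≠ 0 := (Real.sqrt_pos.2 (by exact_mod_cast hL)).ne'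
  rw [outward_eq, Matrix.smul_mulVec, norm_smul, norm_pow, Complex.norm_real, Real.norm_eq_abs,
    abs_of_nonneg (Real.sqrt_nonneg _),
    Real.log_mul (pow_ne_zero _ hL') (norm_ne_zero_iff.2 (hv n)), Real.log_pow]
  field_simp

/-- A vector with a component outside the inherited eigenvectors is expanded at rate `log √L`: its
last coordinate is divided by the product of the geometric sums, which has rate `0`, and the shear
terms grow at most as fast as the eigenvalue products that divide them. -/
lemma hasLyapunovExponent_of_repr_inr_ne_zero (hL : 0 < L)
    (hβ : ∀ j k, (ϱ.fourierMatrix k).mulVec (bas (Sum.inl j))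
      = (β j).eval (phase k) • bas (Sum.inl j))
    (hs : ∀ k, (ϱ.fourierMatrix k).mulVec (bas (Sum.inr ()))
      = (geomPoly L).eval (phase k) • bas (Sum.inr ()) + ∑ j, h j k • bas (Sum.inl j))
    (hH : ∀ j k, ‖h j k‖ ≤ H) (hm : ∀ j, 0 ≤ (β j).logMahlerMeasure) {k : ℝ}
    (hS : OrbitRegular L (geomPoly L) k) (hD : ∀ j, OrbitRegular L (β j) k)
    (hdet : ∀ n, (ϱ.cocycle n k).det ≠ 0) {v : A → ℂ} (hv : bas.repr v (Sum.inr ()) ≠ 0) :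
    ϱ.HasLyapunovExponent k v (Real.log (Real.sqrt L)) := by
  have hrepr (n : ℕ) := repr_cocycle_inv_mulVec hβ hs hS.orbitProd_ne_zero
    (fun j => (hD j).orbitProd_ne_zero) n (hdet n) v
  have hne (n : ℕ) : bas.repr ((ϱ.cocycle n k)⁻¹.mulVec v) (Sum.inr ()) ≠ 0 := by
    rw [(hrepr n).2]
    exact mul_ne_zero hv (inv_ne_zero (hS.orbitProd_ne_zero n))
  have hne' (n : ℕ) : (ϱ.cocycle n k)⁻¹.mulVec v ≠ 0 := fun h0 => hne n (by rw [h0]; simp)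
  rw [← add_zero (Real.log (Real.sqrt L))]
  refine hasLyapunovExponent_of_tendsto_cocycle_inv hL hne'
    (tendsto_of_expUpper (fun n => norm_pos_iff.2 (hne' n)) ?_ ?_)
  · refine expUpper_norm_of_repr bas ?_
    rintro (j | j)
    · have hW := (expUpper_shear hS (hH j) (hD j).expUpper (hm j)).const_mul
        (norm_nonneg (bas.repr v (Sum.inr ())))
      have hnum := ((expUpper_const ‖bas.repr v (Sum.inl j)‖).mono_rate (hm j)).add hW
      have hall := hnum.mul (hD j).expUpper_inv fun n => by positivity
      rw [add_neg_cancel] at hall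
      refine hall.mono fun n => ?_
      rw [(hrepr n).1, norm_mul, norm_inv]
      gcongr
      refine (norm_sub_le _ _).trans ?_
      rw [norm_mul, mul_comm]
    · have hall := hS.expUpper_inv.const_mul (norm_nonneg (bas.repr v (Sum.inr ())))
      rw [logMahlerMeasure_geomPoly, neg_zero] at hall
      refine hall.mono fun n => ?_
      rw [(hrepr n).2, norm_mul, norm_inv]
  · refine expUpper_inv_norm_of_repr bas (Sum.inr ()) hne ?_
    have hall := hS.expUpper.const_mul (norm_nonneg (bas.repr v (Sum.inr ()))⁻¹)
    rw [logMahlerMeasure_geomPoly] at hall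
    rw [neg_zero]
    refine hall.mono fun n => ?_
    rw [(hrepr n).2, ← norm_inv, mul_inv, inv_inv, norm_mul]

/-- On the span of the inherited eigenvectors, the exponent is dictated by the smallest Mahler
measure among the components that occur. -/
lemma hasLyapunovExponent_of_repr_inr_eq_zero (hL : 0 < L)
    (hβ : ∀ j k, (ϱ.fourierMatrix k).mulVec (bas (Sum.inl j))
      = (β j).eval (phase k) • bas (Sum.inl j))
    (hs : ∀ k, (ϱ.fourierMatrix k).mulVec (bas (Sum.inr ()))
      = (geomPoly L).eval (phase k) • bas (Sum.inr ()) + ∑ j, h j k • bas (Sum.inl j))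
    {k : ℝ} (hS : OrbitRegular L (geomPoly L) k) (hD : ∀ j, OrbitRegular L (β j) k)
    (hdet : ∀ n, (ϱ.cocycle n k).det ≠ 0) {v : A → ℂ} (hv : bas.repr v (Sum.inr ()) = 0)
    {i : J} (hi : bas.repr v (Sum.inl i) ≠ 0)
    (hmin : ∀ j, bas.repr v (Sum.inl j) ≠ 0 →
      (β i).logMahlerMeasure ≤ (β j).logMahlerMeasure) :
    ϱ.HasLyapunovExponent k v (Real.log (Real.sqrt L) - (β i).logMahlerMeasure) := by
  have hrepr (n : ℕ) := repr_cocycle_inv_mulVec hβ hs hS.orbitProd_ne_zero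
    (fun j => (hD j).orbitProd_ne_zero) n (hdet n) v
  simp only [hv, mul_zero, sub_zero, zero_mul] at hrepr
  have hne (n : ℕ) : bas.repr ((ϱ.cocycle n k)⁻¹.mulVec v) (Sum.inl i) ≠ 0 := by
    rw [(hrepr n).1]
    exact mul_ne_zero hi (inv_ne_zero ((hD i).orbitProd_ne_zero n))
  have hne' (n : ℕ) : (ϱ.cocycle n k)⁻¹.mulVec v ≠ 0 := fun h0 => hne n (by rw [h0]; simp)
  rw [sub_eq_add_neg]
  have hzero : ExpUpper (fun _ => ‖(0 : ℂ)‖) (-(β i).logMahlerMeasure) := by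
    intro ε hε
    exact ⟨1, one_pos, fun n => by rw [norm_zero]; positivity⟩
  refine hasLyapunovExponent_of_tendsto_cocycle_inv hL hne'
    (tendsto_of_expUpper (fun n => norm_pos_iff.2 (hne' n)) ?_ ?_)
  · refine expUpper_norm_of_repr bas ?_
    rintro (j | j)
    · by_cases hj : bas.repr v (Sum.inl j) = 0
      · simpa only [(hrepr _).1, hj, zero_mul] using hzero
      · refine (((hD j).expUpper_inv.mono_rate (neg_le_neg (hmin j hj))).const_mul
          (norm_nonneg (bas.repr v (Sum.inl j)))).mono fun n => ?_
        rw [(hrepr n).1, norm_mul, norm_inv]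
    · simpa only [(hrepr _).2] using hzero
  · refine expUpper_inv_norm_of_repr bas (Sum.inl i) hne ?_
    rw [neg_neg]
    refine ((hD i).expUpper.const_mul (norm_nonneg (bas.repr v (Sum.inl i))⁻¹)).mono fun n => ?_
    rw [(hrepr n).1, ← norm_inv, mul_inv, inv_inv, norm_mul]

attribute [local instance] Matrix.linftyOpNormedAddCommGroup in
lemma linfty_opNorm_le_sum (M : Matrix A A ℂ) :
    ‖M‖ ≤ ∑ j, ‖M.mulVec (Pi.single j 1)‖ := by
  have h : ‖M‖ ≤ ((∑ j, ‖M.mulVec (Pi.single j 1)‖₊ : NNReal) : ℝ) := by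
    rw [Matrix.linfty_opNorm_def, NNReal.coe_le_coe]
    refine Finset.sup_le fun i _ => Finset.sum_le_sum fun j _ => ?_
    simpa using nnnorm_le_pi_nnnorm (M.mulVec (Pi.single j 1)) i
  simpa using h

attribute [local instance] Matrix.linftyOpNormedAddCommGroup in
/-- The cocycle grows like the largest of its diagonal products, whose rates are the Mahler measures
of the nonzero `β j`, and `0` for the geometric sum. -/
lemma hasMaxCocycleExponent (hβ : ∀ j k, (ϱ.fourierMatrix k).mulVec (bas (Sum.inl j))
      = (β j).eval (phase k) • bas (Sum.inl j))
    (hs : ∀ k, (ϱ.fourierMatrix k).mulVec (bas (Sum.inr ()))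
      = (geomPoly L).eval (phase k) • bas (Sum.inr ()) + ∑ j, h j k • bas (Sum.inl j))
    (hH : ∀ j k, ‖h j k‖ ≤ H) {k c : ℝ}
    (hS : OrbitRegular L (geomPoly L) k) (hD : ∀ j, β j ≠ 0 → OrbitRegular L (β j) k)
    (hc0 : 0 ≤ c) (hc : ∀ j, (β j).logMahlerMeasure ≤ c)
    (hmax : c = 0 ∨ ∃ j, β j ≠ 0 ∧ c = (β j).logMahlerMeasure) :
    ϱ.HasMaxCocycleExponent k c := by
  have hop (n : ℕ) (v : A → ℂ) : ‖(ϱ.cocycle n k).mulVec v‖ ≤ ‖ϱ.cocycle n k‖ * ‖v‖ :=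
    Matrix.linfty_opNorm_mulVec _ _
  have hrepr (n : ℕ) (v : A → ℂ) := repr_cocycle_mulVec hβ hs hS.orbitProd_ne_zero n v
  have hDc (j : J) : ExpUpper (fun n => ‖orbitProd L (β j) n k‖) c := by
    by_cases h0 : β j = 0
    · rw [h0]
      exact (expUpper_orbitProd_zero L k).mono_rate hc0
    · exact (hD j h0).expUpper.mono_rate (hc j)
  have hS0 := hS.expUpper
  rw [logMahlerMeasure_geomPoly] at hS0
  have hvec (v : A → ℂ) : ExpUpper (fun n => ‖(ϱ.cocycle n k).mulVec v‖) c := by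
    refine expUpper_norm_of_repr bas ?_
    rintro (j | j)
    · have hSW := hS0.mul (expUpper_shear hS (hH j) (hDc j) hc0) fun n => norm_nonneg _
      rw [zero_add] at hSW
      refine (((hDc j).const_mul (norm_nonneg (bas.repr v (Sum.inl j)))).add
        (hSW.const_mul (norm_nonneg (bas.repr v (Sum.inr ()))))).mono fun n => ?_
      rw [(hrepr n v).1]
      refine (norm_add_le _ _).trans (le_of_eq ?_)
      simp only [norm_mul]
      ring
    · refine ((hS0.mono_rate hc0).const_mul
        (norm_nonneg (bas.repr v (Sum.inr ())))).mono fun n => ?_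
      rw [(hrepr n v).2, norm_mul, mul_comm]
  have he (n : ℕ) : bas.repr ((ϱ.cocycle n k).mulVec (bas (Sum.inr ()))) (Sum.inr ())
      = orbitProd L (geomPoly L) n k := by
    rw [(hrepr n _).2]
    simp
  have hpos (n : ℕ) : 0 < ‖ϱ.cocycle n k‖ := by
    refine norm_pos_iff.2 fun h0 => hS.orbitProd_ne_zero n ?_
    rw [← he, h0]
    simp
  refine tendsto_of_expUpper hpos ?_ ?_
  · refine (ExpUpper.sum (s := Finset.univ) fun j _ => hvec (Pi.single j 1)).mono fun n => ?_
    exact linfty_opNorm_le_sum _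
  · rcases hmax with hmax | ⟨j, hj, hmax⟩
    · have hinv : ExpUpper (fun n => ‖(ϱ.cocycle n k).mulVec (bas (Sum.inr ()))‖⁻¹) 0 := by
        refine expUpper_inv_norm_of_repr bas (Sum.inr ()) (fun n => ?_) ?_
        · rw [he]
          exact hS.orbitProd_ne_zero n
        · simpa only [he, logMahlerMeasure_geomPoly, neg_zero] using hS.expUpper_inv
      rw [hmax, neg_zero]
      refine (hinv.const_mul (norm_nonneg (bas (Sum.inr ())))).mono fun n => ?_
      have hv0 : 0 < ‖(ϱ.cocycle n k).mulVec (bas (Sum.inr ()))‖ := by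
        refine norm_pos_iff.2 fun h0 => hS.orbitProd_ne_zero n ?_
        rw [← he, h0]
        simp
      rw [← div_eq_mul_inv, le_div_iff₀ hv0, inv_mul_le_iff₀ (hpos n)]
      exact hop n _
    · rw [hmax]
      refine (hD j hj).expUpper_inv.mono fun n => ?_
      refine inv_anti₀ (norm_pos_iff.2 ((hD j hj).orbitProd_ne_zero n)) ?_
      have h1 := hop n (bas (Sum.inl j))
      rw [cocycle_mulVec_eigenvector (hβ j), norm_smul] at h1
      exact le_of_mul_le_mul_right h1 (norm_pos_iff.2 (bas.ne_zero _))

end ConstLengthSubst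

/-! ### The inherited eigenvalues and the proof of the theorem -/

namespace ConstLengthSubst

/-- The polynomial of degree less than `L` with coefficients `c`. -/
noncomputable def coeffPoly {L : ℕ} (c : Fin L → ℂ) : ℂ[X] := ∑ m : Fin L, monomial (m : ℕ) (c m)

section CoeffPoly

variable {L : ℕ} (c : Fin L → ℂ)

lemma coeff_coeffPoly (m : Fin L) : (coeffPoly c).coeff m = c m := by
  simp [coeffPoly, coeff_monomial, Fin.val_inj]

lemma coeff_coeffPoly_of_le {n : ℕ} (hn : L ≤ n) : (coeffPoly c).coeff n = 0 := by
  rw [coeffPoly, finsetSum_coeff]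
  exact Finset.sum_eq_zero fun m _ => coeff_monomial_of_ne _ (by omega)

lemma degree_coeffPoly_lt : (coeffPoly c).degree < L :=
  (degree_lt_iff_coeff_zero _ _).2 fun _ hn => coeff_coeffPoly_of_le c hn

lemma eval_coeffPoly (u : ℂ) : (coeffPoly c).eval u = ∑ m : Fin L, u ^ (m : ℕ) * c m := by
  simp [coeffPoly, eval_finsetSum, mul_comm]

lemma norm_coeff_coeffPoly (hc : ∀ m, c m ≠ 0 → ‖c m‖ = 1) (n : ℕ)
    (hn : (coeffPoly c).coeff n ≠ 0) : ‖(coeffPoly c).coeff n‖ = 1 := by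
  rcases lt_or_ge n L with h | h
  · have h1 : (coeffPoly c).coeff n = c ⟨n, h⟩ := coeff_coeffPoly c ⟨n, h⟩
    rw [h1] at hn ⊢
    exact hc _ hn
  · exact absurd (coeff_coeffPoly_of_le c h) hn

end CoeffPoly

section TwoBlockBasis

variable {V J : Type*} [AddCommGroup V] [Module ℂ V] [Fintype J]

lemma sum_repr_inl_add_inr (bas : Module.Basis (J ⊕ Unit) ℂ V) (v : V) :
    ∑ j, bas.repr v (Sum.inl j) • bas (Sum.inl j) + bas.repr v (Sum.inr ()) • bas (Sum.inr ())
      = v := by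
  have h := bas.sum_repr v
  rw [Fintype.sum_sum_type] at h
  simpa only [Finset.univ_unique, Finset.sum_singleton] using h

variable {bas : Module.Basis (J ⊕ Unit) ℂ V}

lemma mem_span_of_repr_inr_eq_zero {v : V} (hv : bas.repr v (Sum.inr ()) = 0) :
    v ∈ Submodule.span ℂ (Set.range fun j => bas (Sum.inl j)) := by
  rw [← sum_repr_inl_add_inr bas v, hv, zero_smul, add_zero]
  exact Submodule.sum_mem _ fun j _ => Submodule.smul_mem _ _ (Submodule.subset_span ⟨j, rfl⟩)

lemma exists_repr_inl_ne_zero {v : V} (hv0 : v ≠ 0) (hv : bas.repr v (Sum.inr ()) = 0) :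
    ∃ j, bas.repr v (Sum.inl j) ≠ 0 := by
  by_contra! h
  refine hv0 (bas.repr.map_eq_zero_iff.1 (Finsupp.ext ?_))
  rintro (j | j)
  · exact h j
  · exact hv

end TwoBlockBasis

lemma exists_eq_zero_or_eq_max {J : Type*} [Finite J] (m : J → ℝ) :
    ∃ c, 0 ≤ c ∧ (∀ j, m j ≤ c) ∧ (c = 0 ∨ ∃ j, c = m j) := by
  obtain ⟨i, hi⟩ := Finite.exists_max fun o : Option J => o.elim 0 m
  refine ⟨i.elim 0 m, hi none, fun j => hi (some j), ?_⟩
  cases i with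
  | none => exact Or.inl rfl
  | some j => exact Or.inr ⟨j, rfl⟩

section Decomposition

variable {A J : Type*} {L : ℕ} [DecidableEq A] [Fintype A] [Fintype J]
  (ϱ : ConstLengthSubst A L)

lemma fourierMatrix_mulVec_eigenvector {v : A → ℂ} {c : Fin L → ℂ}
    (hv : ∀ m, (ϱ.columnMatrix m).mulVec v = c m • v) (k : ℝ) :
    (ϱ.fourierMatrix k).mulVec v = (coeffPoly c).eval (phase k) • v := by
  rw [fourierMatrix_eq_sum, Matrix.sum_mulVec, eval_coeffPoly, Finset.sum_smul]
  simp only [Matrix.smul_mulVec, hv, smul_smul]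

lemma bijectivePart_mulVec_eigenvector {v : A → ℂ} {c : Fin L → ℂ}
    (hv : ∀ m, (ϱ.columnMatrix m).mulVec v = c m • v)
    (hc : ∀ m, ¬ ϱ.BijectiveColumn m → c m = 0) (k : ℝ) :
    (ϱ.bijectivePart k).mulVec v = (coeffPoly c).eval (phase k) • v := by
  rw [bijectivePart_eq_sum, Matrix.sum_mulVec, eval_coeffPoly, Finset.sum_smul]
  simp only [Matrix.smul_mulVec, hv, smul_smul]
  refine Finset.sum_subset (Finset.filter_subset _ _) fun m _ hm => ?_
  rw [hc m (by simpa using hm), mul_zero, zero_smul]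

lemma bijectivePart_mulVec_one (k : ℝ) :
    (ϱ.bijectivePart k).mulVec 1
      = (∑ m with ϱ.BijectiveColumn m, phase k ^ (m : ℕ)) • (1 : A → ℂ) := by
  rw [bijectivePart_eq_sum, Matrix.sum_mulVec, Finset.sum_smul]
  refine Finset.sum_congr rfl fun m hm => ?_
  rw [Matrix.smul_mulVec, columnMatrix_mulVec_of_bijective ϱ (by simpa using hm)]
  rfl

variable {ϱ} {bas : Module.Basis (J ⊕ Unit) ℂ (A → ℂ)}

/-- The diagonal entry belonging to the vector of ones is detected by the entry sum. -/
lemma fourierMatrix_mulVec_inr [Nonempty A] (hb0 : ∀ j, entrySum A (bas (Sum.inl j)) = 0)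
    (h1 : bas (Sum.inr ()) = 1) (k : ℝ) :
    (ϱ.fourierMatrix k).mulVec (bas (Sum.inr ()))
      = (geomPoly L).eval (phase k) • bas (Sum.inr ())
        + ∑ j, bas.repr ((ϱ.fourierMatrix k).mulVec (bas (Sum.inr ()))) (Sum.inl j) •
            bas (Sum.inl j) := by
  have hdec := sum_repr_inl_add_inr bas ((ϱ.fourierMatrix k).mulVec (bas (Sum.inr ())))
  have hsum := congrArg (entrySum A) hdec
  rw [entrySum_fourierMatrix_mulVec, ← geomPoly_eval, map_add, map_sum,
    Finset.sum_eq_zero fun j _ => by rw [map_smul, hb0, smul_zero], zero_add, map_smul,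
    smul_eq_mul] at hsum
  have hone : entrySum A (bas (Sum.inr ())) ≠ 0 := by
    rw [h1, entrySum_apply]
    simp
  rw [mul_right_cancel₀ hone hsum, add_comm] at hdec
  exact hdec.symm

lemma exists_norm_repr_fourierMatrix_mulVec_le (v : A → ℂ) :
    ∃ H, ∀ (j : J) (k : ℝ), ‖bas.repr ((ϱ.fourierMatrix k).mulVec v) (Sum.inl j)‖ ≤ H := by
  refine ⟨∑ j : J, ∑ t, ‖bas.repr ((ϱ.columnMatrix t).mulVec v) (Sum.inl j)‖, fun j k => ?_⟩
  refine le_trans ?_ (Finset.single_le_sum (f := fun j : J => ∑ t,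
    ‖bas.repr ((ϱ.columnMatrix t).mulVec v) (Sum.inl j)‖)
    (fun _ _ => Finset.sum_nonneg fun _ _ => norm_nonneg _) (Finset.mem_univ j))
  rw [fourierMatrix_eq_sum, Matrix.sum_mulVec, map_sum, Finsupp.finsetSum_apply]
  refine norm_sum_le_of_le _ fun t _ => ?_
  rw [Matrix.smul_mulVec, map_smul, Finsupp.smul_apply, norm_smul, norm_pow, norm_phase, one_pow,
    one_mul]

end Decomposition

end ConstLengthSubst

open ConstLengthSubst in
theorem theorem4p6 {A : Type*} [Fintype A] [DecidableEq A] [Nonempty A] (L : ℕ) (hL : 2 ≤ L)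
    (ϱ : ConstLengthSubst A L)
    (hcol : ∀ m, ϱ.BijectiveColumn m ∨ ϱ.ConstantColumn m)
    (hab : ∀ g ∈ ϱ.columnGroup, ∀ h ∈ ϱ.columnGroup, g * h = h * g) :
    -- `β j`: the inherited eigenvalues, as polynomials in `u`; `b j`: their eigenvectors
    ∃ (b : Fin (Fintype.card A - 1) → (A → ℂ)) (β : Fin (Fintype.card A - 1) → ℂ[X]),
      LinearIndependent ℂ b ∧
      (∀ j, (β j).degree < (L : ℕ)) ∧
      (∀ j k, (ϱ.bijectivePart k).mulVec (b j)
        = (β j).eval (ConstLengthSubst.phase k) • b j) ∧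
      (∀ j k, (ϱ.fourierMatrix k).mulVec (b j)
        = (β j).eval (ConstLengthSubst.phase k) • b j) ∧
      (∀ j, (β j).logMahlerMeasure < Real.log (Real.sqrt L)) ∧
      -- all eigenvalues, with multiplicities, of the bijective part and of the Fourier matrix
      (∀ k, (ϱ.bijectivePart k).charpoly
        = (X - C (∑ m with ϱ.BijectiveColumn m, ConstLengthSubst.phase k ^ (m : ℕ)))
          * ∏ j, (X - C ((β j).eval (ConstLengthSubst.phase k)))) ∧
      (∀ k, (ϱ.fourierMatrix k).charpoly
        = (X - C (∑ m ∈ Finset.range L, ConstLengthSubst.phase k ^ m))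
          * ∏ j, (X - C ((β j).eval (ConstLengthSubst.phase k)))) ∧
      -- the minimal exponent `log √L - c` of the outward iteration is positive
      (∃ c < Real.log (Real.sqrt L), ∀ᵐ k : ℝ, ϱ.HasMaxCocycleExponent k c) ∧
      -- the outward iteration is defined, and all of its exponents are positive
      ((∃ m, ϱ.BijectiveColumn m) →
        ∀ᵐ k : ℝ, (∀ n : ℕ, (ϱ.fourierMatrix ((L : ℝ) ^ n * k)).det ≠ 0) ∧
          (∀ j, ϱ.HasLyapunovExponent k (b j)
            (Real.log (Real.sqrt L) - (β j).logMahlerMeasure)) ∧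
          (∀ v, v ∉ Submodule.span ℂ (Set.range b) →
            ϱ.HasLyapunovExponent k v (Real.log (Real.sqrt L))) ∧
          ∀ v : A → ℂ, v ≠ 0 → ∃ χ : ℝ, ϱ.HasLyapunovExponent k v χ ∧ 0 < χ ∧
            (χ = Real.log (Real.sqrt L) ∨
              ∃ j, χ = Real.log (Real.sqrt L) - (β j).logMahlerMeasure)) := by
  obtain ⟨b, c, hb, hb0, hc, hc1, hc0⟩ := exists_column_eigenbasis ϱ hcol hab
  obtain ⟨bas, hbas, hbas1⟩ := exists_basis_extend_ones hb hb0
  set β : Fin (Fintype.card A - 1) → ℂ[X] := fun j => coeffPoly (c j) with hβdef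
  have hcn (j : Fin (Fintype.card A - 1)) (m : Fin L) (h : c j m ≠ 0) : ‖c j m‖ = 1 :=
    hc1 j m (not_not.1 fun hm => h (hc0 j m hm))
  have hcoeff (j : Fin (Fintype.card A - 1)) (n : ℕ) (h : (β j).coeff n ≠ 0) :
      ‖(β j).coeff n‖ = 1 := norm_coeff_coeffPoly (c j) (hcn j) n h
  have hdeg (j : Fin (Fintype.card A - 1)) : (β j).degree < (L : ℕ) := degree_coeffPoly_lt (c j)
  have hL0 : 0 < L := by omega
  have hBb (j : Fin (Fintype.card A - 1)) (k : ℝ) :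
      (ϱ.bijectivePart k).mulVec (b j) = (β j).eval (phase k) • b j :=
    bijectivePart_mulVec_eigenvector ϱ (hc j) (hc0 j) k
  have hB (j : Fin (Fintype.card A - 1)) (k : ℝ) :
      (ϱ.fourierMatrix k).mulVec (b j) = (β j).eval (phase k) • b j :=
    fourierMatrix_mulVec_eigenvector ϱ (hc j) k
  have hβ (j : Fin (Fintype.card A - 1)) (k : ℝ) :
      (ϱ.fourierMatrix k).mulVec (bas (Sum.inl j)) = (β j).eval (phase k) • bas (Sum.inl j) := by
    rw [hbas, hB]
  have hs := fourierMatrix_mulVec_inr (ϱ := ϱ) (fun j => by rw [hbas]; exact hb0 j) hbas1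
  obtain ⟨H, hH⟩ := exists_norm_repr_fourierMatrix_mulVec_le (ϱ := ϱ) (bas := bas)
    (bas (Sum.inr ()))
  have hm_lt (j : Fin (Fintype.card A - 1)) :
      (β j).logMahlerMeasure < Real.log (Real.sqrt L) := by
    refine logMahlerMeasure_lt_log_sqrt hL (hdeg j) fun n => ?_
    by_cases h : (β j).coeff n = 0
    · rw [h, norm_zero]
      exact zero_le_one
    · exact (hcoeff j n h).le
  have hm_nonneg (j : Fin (Fintype.card A - 1)) : 0 ≤ (β j).logMahlerMeasure :=
    logMahlerMeasure_nonneg_of_norm_coeff (hcoeff j)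
  have hlogL : 0 < Real.log (Real.sqrt L) := by
    refine Real.log_pos (Real.lt_sqrt_of_sq_lt ?_)
    rw [one_pow]
    exact_mod_cast (by omega : 1 < L)
  have hcharB (k : ℝ) := charpoly_of_almost_diagonal _ bas (fun j => hβ j k) (hs k)
  have haeS : ∀ᵐ k : ℝ, OrbitRegular L (geomPoly L) k :=
    ae_orbitRegular hL (geomPoly_ne_zero hL0)
  have haeD : ∀ᵐ k : ℝ, ∀ j, β j ≠ 0 → OrbitRegular L (β j) k := by
    refine ae_all_iff.2 fun j => ?_
    by_cases h : β j = 0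
    · exact ae_of_all _ fun k hk => absurd h hk
    · filter_upwards [ae_orbitRegular hL h] with k hk _ using hk
  refine ⟨b, β, hb, hdeg, hBb, hB, hm_lt, fun k => ?_, fun k => ?_, ?_, ?_⟩
  · refine charpoly_of_almost_diagonal (h := 0) _ bas (fun j => by rw [hbas, hBb]) ?_
    simp [hbas1, bijectivePart_mulVec_one]
  · rw [← geomPoly_eval]
    exact hcharB k
  · obtain ⟨C, hC0, hCle, hCmax⟩ := exists_eq_zero_or_eq_max fun j => (β j).logMahlerMeasure
    refine ⟨C, ?_, ?_⟩
    · rcases hCmax with h | ⟨j, h⟩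
      · rw [h]
        exact hlogL
      · rw [h]
        exact hm_lt j
    · filter_upwards [haeS, haeD] with k hS hD
      refine hasMaxCocycleExponent hβ hs hH hS hD hC0 hCle ?_
      rcases hCmax with h | ⟨j, h⟩
      · exact Or.inl h
      · by_cases hj : β j = 0
        · refine Or.inl (h.trans ?_)
          simp only [hj, logMahlerMeasure_zero]
        · exact Or.inr ⟨j, hj, h⟩
  · rintro ⟨m, hm⟩
    have hβ0 (j : Fin (Fintype.card A - 1)) : β j ≠ 0 := by
      intro h
      have h1 : (β j).coeff m = c j m := coeff_coeffPoly (c j) m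
      have h2 := hc1 j m hm
      rw [← h1, h] at h2
      simp at h2
    filter_upwards [haeS, haeD] with k hS hD'
    have hD (j : Fin (Fintype.card A - 1)) := hD' j (hβ0 j)
    have hdetB (n : ℕ) : (ϱ.fourierMatrix ((L : ℝ) ^ n * k)).det ≠ 0 :=
      det_ne_zero_of_charpoly_eq (hcharB _) (hS.1 n) fun j => (hD j).1 n
    have hdet := det_cocycle_ne_zero ϱ hdetB
    have hspan {v : A → ℂ} (hv : bas.repr v (Sum.inr ()) ≠ 0) :
        ϱ.HasLyapunovExponent k v (Real.log (Real.sqrt L)) :=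
      hasLyapunovExponent_of_repr_inr_ne_zero hL0 hβ hs hH hm_nonneg hS hD hdet hv
    refine ⟨hdetB, fun j => ?_, fun v hv => ?_, fun v hv => ?_⟩
    · have hr : bas.repr (b j) = Finsupp.single (Sum.inl j) 1 := by
        rw [← hbas, bas.repr_self]
      refine hasLyapunovExponent_of_repr_inr_eq_zero hL0 hβ hs hS hD hdet (i := j) ?_ ?_ ?_
      · simp [hr]
      · simp [hr]
      · intro i hi
        by_cases hij : i = j
        · rw [hij]
        · exact absurd (by simp [hr, Ne.symm hij]) hi
    · refine hspan fun h => hv ?_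
      simpa only [hbas] using mem_span_of_repr_inr_eq_zero h
    · by_cases h : bas.repr v (Sum.inr ()) = 0
      · obtain ⟨j, hj⟩ := exists_repr_inl_ne_zero hv h
        obtain ⟨i, hi, hmin⟩ := Set.exists_min_image {j | bas.repr v (Sum.inl j) ≠ 0}
          (fun j => (β j).logMahlerMeasure) (Set.toFinite _) ⟨j, hj⟩
        exact ⟨_, hasLyapunovExponent_of_repr_inr_eq_zero hL0 hβ hs hS hD hdet h hi hmin,
          sub_pos.2 (hm_lt i), Or.inr ⟨i, rfl⟩⟩
      · exact ⟨_, hspan h, hlogL, Or.inl rfl⟩
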